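/- **Setting.** Let $(\xi_j)_{j\in\mathbb Z}$ be i.i.d. real random variables. For a sequence $(a_j)_{j\in\mathbb Z}$ and a number $\xi_*$ let $\mathcal T_n$ be the $n\times n$ Toeplitz matrix with entries $(\mathcal T_n)_{ij}=a_{j-i}$ and let $\mathcal B_n$ be the $n\times n$ Toeplitz matrix with entries $(\mathcal B_n)_{ii}=\xi_*$, $(\mathcal B_n)_{ij}=a_{j-i-n}$ for $i<j$ and $(\mathcal B_n)_{ij}=a_{n+j-i}$ for $i>j$, so that $\begin{bmatrix}\mathcal T_n&\mathcal B_n\\ \mathcal B_n&\mathcal T_n\end{bmatrix}$ is a circulant matrix of size $2n$. Put $\mathcal A_n=\begin{bmatrix}\mathcal T_n\\ \mathcal B_n\end{bmatrix}\in\mathbb R^{2n\times n}$. In the *non-symmetric case* $a_j=\xi_j$, in the *symmetric case* $a_j=\xi_{|j|}$. Here $\xi_*$ may be any random variable independent of the $\xi_j$ that occur in $\mathcal T_n$ (for example a constant, or a further i.i.d. copy such as $\xi_n$); its law may depend on $n$. The condition number of $A\in\mathbb R^{m\times n}$ is $\kappa(A)=\sigma_{\max}(A)/d(A,\Sigma)$,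 where $\Sigma$ is the set of $m\times n$ matrices of rank less than $\min\{m,n\}$ and $d$ is the distance in the Euclidean operator norm; $\kappa(A)=\infty$ if $A\in\Sigma$. Condition (H) on a random variable $\xi$: there are $M>0$ and $q\in(0,1)$ with $\sup_{u\in\mathbb R}\mathbb P(|\xi-u|\le 1)\le 1-q$ and $\mathbb P(|\xi|>M)\le q/2$. **Theorem.** Suppose that $\xi_0$ has zero mean and finite positive variance, that its moment generating function is finite in an open interval around zero, and that $\xi_0$ satisfies (H). 1. (Non-symmetric case.) There are constants $C_0,C_1>0$ and a sequence $o(1)\to 0$, depending only on the distribution of $\xi_0$, such that for any $\varepsilon>0$ and $\rho\in(0,1/4)$, for all large $n$, $$\mathbb P\Big(\kappa(\mathcal A_n)\le \frac{C_0}{\varepsilon}\,n^{\rho+1/2}(\log n)^{1/2}\Big)\ \ge\ 1-C_1\Big((\varepsilon^2+\varepsilon)\,n^{-2\rho}+n^{-1/2+o(1)}\Big).$$ 2. (Symmetric case.) There are constants $C_0,C_1>0$ and a sequence $o(1)\to 0$, depending only on the distribution of $\xi_0$, such that for any $\varepsilon>0$, for all large $n$, $$\mathbb P\Big(\kappa(\mathcal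 A_n)\le \frac{C_0}{\varepsilon}\,n^{1.01}(\log n)^{1/2}\Big)\ \ge\ 1-C_1\Big(\varepsilon\, n^{-0.1}+n^{-77/300+o(1)}\Big).$$ Here "for all large $n$" means for all $n\ge N$, where $N$ depends only on the distribution of $\xi_0$, on $\varepsilon$ and (in part 1) on $\rho$. -/

import Mathlib

open MeasureTheory ProbabilityTheory Filter Topology

/-- The Toeplitz matrix `T_n` with entry `a (j - i)` in row `i` and column `j`: the first row is
`a 0, a 1, …, a (n-1)` and the first column is `a 0, a (-1), …, a (-(n-1))`. -/
def toeplitz (n : ℕ) (a : ℤ → ℝ) : Matrix (Fin n) (Fin n) ℝ :=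
  Matrix.of fun i j => a ((j : ℤ) - (i : ℤ))

/-- The Toeplitz matrix `B_n` of the circulant embedding of `toeplitz n a`: the diagonal entries are
all equal to `s`, the first row is `s, a (-(n-1)), …, a (-1)` and the first column is
`s, a (n-1), …, a 1`. The block matrix `[T_n, B_n; B_n, T_n]` is then circulant. -/
def embeddingBlock (n : ℕ) (a : ℤ → ℝ) (s : ℝ) : Matrix (Fin n) (Fin n) ℝ :=
  Matrix.of fun i j =>
    if i = j then s
    else if i < j then a ((j : ℤ) - (i : ℤ) - (n : ℤ))
    else a ((n : ℤ) + (j : ℤ) - (i : ℤ))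

/-- The `2n × n` matrix `A_n = [T_n; B_n]`. -/
def stackedToeplitz (n : ℕ) (a : ℤ → ℝ) (s : ℝ) : Matrix (Fin n ⊕ Fin n) (Fin n) ℝ :=
  Matrix.fromRows (toeplitz n a) (embeddingBlock n a s)

noncomputable section

/-- The largest singular value of a real matrix, i.e. the square root of the largest eigenvalue
of `Aᵀ A`. -/
def sigmaMax {m n : Type*} [Fintype m] [Fintype n] [DecidableEq n] (A : Matrix m n ℝ) : ℝ :=
  (Matrix.toEuclideanLin A).singularValues 0

/-- The operator norm of a real matrix with respect to the Euclidean norms. -/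
def euclideanOpNorm {m n : Type*} [Fintype m] [Fintype n] [DecidableEq n] (A : Matrix m n ℝ) : ℝ :=
  ‖LinearMap.toContinuousLinearMap (Matrix.toEuclideanLin A)‖

/-- The set `Σ` of matrices that do not have full rank. -/
def rankDeficient (m n : Type*) [Fintype m] [Fintype n] : Set (Matrix m n ℝ) :=
  {B | B.rank < min (Fintype.card m) (Fintype.card n)}

/-- The distance `d(A, Σ)` in the operator norm, with values in `[0, ∞]`. -/
def distRankDeficient {m n : Type*} [Fintype m] [Fintype n] [DecidableEq n]
    (A : Matrix m n ℝ) : ENNReal :=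
  ⨅ B ∈ rankDeficient m n, ENNReal.ofReal (euclideanOpNorm (A - B))

open Classical in
/-- The condition number `κ(A) = σ_max(A) / d(A, Σ)`, equal to `∞` if `A` does not have
full rank. -/
def condNumber {m n : Type*} [Fintype m] [Fintype n] [DecidableEq n]
    (A : Matrix m n ℝ) : ENNReal :=
  if A ∈ rankDeficient m n then ⊤
  else ENNReal.ofReal (sigmaMax A) / distRankDeficient A

end

/-- Condition (H) for the law `μ` of a real random variable `ξ`: for some `M > 0` and `q ∈ (0,1)`,
`sup_u P(|ξ - u| ≤ 1) ≤ 1 - q` and `P(|ξ| > M) ≤ q / 2`. -/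
def ConditionH (μ : Measure ℝ) : Prop :=
  ∃ M q : ℝ, 0 < M ∧ 0 < q ∧ q < 1 ∧
    (∀ u : ℝ, μ.real {x | |x - u| ≤ 1} ≤ 1 - q) ∧ μ.real {x | M < |x|} ≤ q / 2

/-- The moment generating function of the law `μ` is finite in an open interval around zero. -/
def HasMgfNearZero (μ : Measure ℝ) : Prop :=
  ∃ δ : ℝ, 0 < δ ∧ ∀ t ∈ Set.Ioo (-δ) δ, Integrable (fun x : ℝ => Real.exp (t * x)) μ

/-- `(ξ_j)_{j ∈ ℤ}` are i.i.d. real random variables with law `μ`. -/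
def IsIID {Ω : Type*} [MeasurableSpace Ω] (P : Measure Ω) (μ : Measure ℝ)
    (ξ : ℤ → Ω → ℝ) : Prop :=
  (∀ j, Measurable (ξ j)) ∧ (∀ j, P.map (ξ j) = μ) ∧ iIndepFun ξ P

/-! The matrix consists of n columns of a circulant matrix of size 2n. By Parseval, 2n‖A x‖² = Σ_k
|λ_k|² |x̂(k)|², where the λ_k are the circulant eigenvalues and x̂ is the transform of x extended
by zero (`sum_normSq_eigenvalue_mul`). Hence ‖A x‖ ≤ max |λ_k| ‖x‖, and a Chernoff bound
(`exists_tail_linearForm`) keeps every λ_k, up to the term containing ξ_*, of order √(n log n).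

For the lower bound, min |λ_k| is not enough. Only the real parts are controlled from below; each
may lie in [-1, 1] with probability of order n^{-1/2}, so a union bound over n frequencies fails.
What helps is that x fills only half of the group. By the uncertainty principle
`sum_normSq_zmodFourier_le`, a fixed share of the mass of x̂ lies off the set S = {|λ_k| ≤ 1},
provided that each k in S has at most one other element of S within distance 2^15. For the proof, x̂
is tested against a polynomial of degree below n which is concentrated at k and vanishes at that
neighbour; the contribution of the remaining part of S is then absorbed by Young's inequality. So
the smallest singular value is bounded below by an absolute constant.

The condition on S fails with probability O(n^{-1/2}). Distinct cosine vectors with frequencies in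
[0, n] are nearly orthogonal, so three real parts are simultaneously small with probability
O(n^{-3/2}) (`exists_smallBall_linearForms`), and there are only O(n) close triples. Real parts are
even in k, so k and -k are close near 0 and n; there single real parts are excluded instead, at cost
O(n^{-1/2}). An independent ξ_* only shifts the linear forms, and a very large one makes all
eigenvalues comparable.

Altogether κ ≤ K√(n log n) with probability at least 1 - C n^{-1/2} (`exists_condNumber_le`), in
both cases. This is stronger than the claim: the additional power of n absorbs K and 1/ε once n is
large. -/

/-! ### From two-sided norm bounds to the condition number. -/

/-- If `‖A x‖ ≤ R ‖x‖` for all `x`, then `σ_max(A) ≤ R`. -/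
theorem sigmaMax_le {m n : Type*} [Fintype m] [Fintype n] [DecidableEq n] (A : Matrix m n ℝ)
    {R : ℝ} (hR : 0 ≤ R)
    (h : ∀ x : EuclideanSpace ℝ n, ‖Matrix.toEuclideanLin A x‖ ≤ R * ‖x‖) :
    sigmaMax A ≤ R := by
  unfold sigmaMax
  set T := Matrix.toEuclideanLin A
  by_cases hn : 0 < Module.finrank ℝ (EuclideanSpace ℝ n)
  · obtain ⟨v, hv⟩ := (T.hasEigenvalue_adjoint_comp_self_sq_singularValues hn).exists_hasEigenvector
    have hv0 : 0 < ‖v‖ := norm_pos_iff.2 hv.2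
    have h1 : ‖T v‖ ^ 2 = (T.singularValues 0) ^ 2 * ‖v‖ ^ 2 := by
      rw [← real_inner_self_eq_norm_sq, ← LinearMap.adjoint_inner_left,
        ← LinearMap.comp_apply, hv.apply_eq_smul, inner_smul_left, real_inner_self_eq_norm_sq]
      simp
    have h2 : (T.singularValues 0 * ‖v‖) ^ 2 ≤ (R * ‖v‖) ^ 2 := by
      rw [mul_pow, ← h1]
      exact pow_le_pow_left₀ (norm_nonneg _) (h v) 2
    exact le_of_mul_le_mul_right (le_of_sq_le_sq h2 (by positivity)) hv0
  · rw [T.singularValues_of_finrank_le (by omega)]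
    exact hR

/-- If `m ‖x‖ ≤ ‖A x‖` for all `x`, then `A` has distance at least `m` to every matrix of rank
less than the number of columns. -/
theorem le_euclideanOpNorm_sub {m n : Type*} [Fintype m] [Fintype n] [DecidableEq n]
    (A B : Matrix m n ℝ) {c : ℝ}
    (h : ∀ x : EuclideanSpace ℝ n, c * ‖x‖ ≤ ‖Matrix.toEuclideanLin A x‖)
    (hB : B.rank < Fintype.card n) : c ≤ euclideanOpNorm (A - B) := by
  -- A rank-deficient B kills some nonzero x, and on this x the matrices A and A - B agree.
  have hker : LinearMap.ker (Matrix.toEuclideanLin B) ≠ ⊥ := by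
    intro hk
    have h1 := (Matrix.toEuclideanLin B).finrank_range_add_finrank_ker
    rw [hk, finrank_bot, finrank_euclideanSpace, Matrix.toEuclideanLin_eq_toLin_orthonormal,
      ← Matrix.rank_eq_finrank_range_toLin B
      (EuclideanSpace.basisFun m ℝ).toBasis (EuclideanSpace.basisFun n ℝ).toBasis] at h1
    omega
  obtain ⟨x, hx, hx0⟩ := Submodule.exists_mem_ne_zero_of_ne_bot hker
  have hxp : 0 < ‖x‖ := norm_pos_iff.2 hx0
  have h2 := (LinearMap.toContinuousLinearMap (Matrix.toEuclideanLin (A - B))).le_opNorm x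
  have h3 : LinearMap.toContinuousLinearMap (Matrix.toEuclideanLin (A - B)) x
      = Matrix.toEuclideanLin A x := by
    have : Matrix.toEuclideanLin B x = 0 := hx
    simp [this]
  rw [h3] at h2
  exact le_of_mul_le_mul_right ((h x).trans h2) hxp

/-- Two-sided bounds on `‖A x‖` bound the condition number of a matrix with at least as many rows
as columns. -/
theorem condNumber_le {m n : Type*} [Fintype m] [Fintype n] [DecidableEq n]
    (hmn : Fintype.card n ≤ Fintype.card m) (A : Matrix m n ℝ) {c R : ℝ} (hc : 0 < c)
    (hR : 0 ≤ R)
    (hlow : ∀ x : EuclideanSpace ℝ n, c * ‖x‖ ≤ ‖Matrix.toEuclideanLin A x‖)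
    (hup : ∀ x : EuclideanSpace ℝ n, ‖Matrix.toEuclideanLin A x‖ ≤ R * ‖x‖) :
    condNumber A ≤ ENNReal.ofReal (R / c) := by
  have hfull : A ∉ rankDeficient m n := by
    intro hA
    have := le_euclideanOpNorm_sub A A hlow (by simpa [rankDeficient, hmn] using hA)
    simp [euclideanOpNorm] at this
    linarith
  rw [condNumber, if_neg hfull, ENNReal.ofReal_div_of_pos hc]
  refine ENNReal.div_le_div (ENNReal.ofReal_le_ofReal (sigmaMax_le A hR hup)) ?_
  refine le_iInf₂ fun B hB => ENNReal.ofReal_le_ofReal ?_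
  exact le_euclideanOpNorm_sub A B hlow (by simpa [rankDeficient, hmn] using hB)

/-! ### Fourier analysis on `ZMod N` and the averaging kernel. -/

/-- The discrete Fourier transform on `ZMod N`, with the sign convention `∑ f(z) e(zk/N)`. -/
noncomputable def zmodFourier {N : ℕ} [NeZero N] (f : ZMod N → ℂ) (k : ZMod N) : ℂ :=
  ∑ z, f z * ZMod.stdAddChar (z * k)

theorem sum_stdAddChar_mul {N : ℕ} [NeZero N] (b : ZMod N) :
    ∑ k : ZMod N, (ZMod.stdAddChar (b * k) : ℂ) = if b = 0 then (N : ℂ) else 0 := by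
  have := AddChar.sum_mulShift b (ZMod.isPrimitive_stdAddChar N)
  simp only [mul_comm b]
  rw [this]
  simp [ZMod.card]

theorem conj_stdAddChar {N : ℕ} [NeZero N] (b : ZMod N) :
    (starRingEnd ℂ) (ZMod.stdAddChar b : ℂ) = ZMod.stdAddChar (-b) :=
  (AddChar.map_neg_eq_conj _ _).symm

theorem sum_normSq_zmodFourier {N : ℕ} [NeZero N] (f : ZMod N → ℂ) :
    ∑ k, ‖zmodFourier f k‖ ^ 2 = N * ∑ z, ‖f z‖ ^ 2 := by
  have key : ∑ k, zmodFourier f k * (starRingEnd ℂ) (zmodFourier f k)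
      = N * ∑ z, f z * (starRingEnd ℂ) (f z) := by
    calc ∑ k, zmodFourier f k * (starRingEnd ℂ) (zmodFourier f k)
        = ∑ k, ∑ z, ∑ w, f z * (starRingEnd ℂ) (f w) * ZMod.stdAddChar ((z - w) * k) := by
          refine Finset.sum_congr rfl fun k _ => ?_
          simp only [zmodFourier, map_sum, map_mul, conj_stdAddChar, Finset.sum_mul_sum]
          refine Finset.sum_congr rfl fun z _ => Finset.sum_congr rfl fun w _ => ?_
          rw [sub_mul, sub_eq_add_neg, AddChar.map_add_eq_mul]
          ring
      _ = ∑ z, ∑ w, f z * (starRingEnd ℂ) (f w) *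
            ∑ k, (ZMod.stdAddChar ((z - w) * k) : ℂ) := by
          rw [Finset.sum_comm]
          refine Finset.sum_congr rfl fun z _ => ?_
          rw [Finset.sum_comm]
          simp only [Finset.mul_sum]
      _ = N * ∑ z, f z * (starRingEnd ℂ) (f z) := by
          simp only [sum_stdAddChar_mul, sub_eq_zero, mul_ite, mul_zero, Finset.sum_ite_eq,
            Finset.mem_univ, if_true, Finset.mul_sum]
          exact Finset.sum_congr rfl fun z _ => by ring
  simp only [Complex.mul_conj, Complex.normSq_eq_norm_sq] at key
  exact_mod_cast key

/-- The Fourier transform of a function on `ZMod (2n)` supported on `[0, n)` is orthogonal to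
all polynomials of degree less than `n` in the standard character, up to a shift. -/
theorem sum_zmodFourier_mul_eval_eq_zero {n : ℕ} [NeZero (n + n)] (X : ZMod (n + n) → ℂ)
    (hX : ∀ z, n ≤ z.val → X z = 0) (Q : Polynomial ℂ) (hQ : Q.natDegree < n) :
    ∑ l, zmodFourier X l * (ZMod.stdAddChar l * Q.eval (ZMod.stdAddChar l : ℂ)) = 0 := by
  calc ∑ l, zmodFourier X l * (ZMod.stdAddChar l * Q.eval (ZMod.stdAddChar l : ℂ))
      = ∑ l, ∑ z, ∑ p ∈ Finset.range n,
          X z * Q.coeff p * ZMod.stdAddChar ((z + ((p + 1 : ℕ) : ZMod (n + n))) * l) := by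
        refine Finset.sum_congr rfl fun l _ => ?_
        rw [Polynomial.eval_eq_sum_range' hQ, zmodFourier, Finset.mul_sum, Finset.sum_mul_sum]
        refine Finset.sum_congr rfl fun z _ => Finset.sum_congr rfl fun p _ => ?_
        rw [add_mul, AddChar.map_add_eq_mul, ← nsmul_eq_mul, AddChar.map_nsmul_eq_pow]
        ring
    _ = ∑ z, ∑ p ∈ Finset.range n, X z * Q.coeff p *
          ∑ l, (ZMod.stdAddChar ((z + ((p + 1 : ℕ) : ZMod (n + n))) * l) : ℂ) := by
        rw [Finset.sum_comm]
        refine Finset.sum_congr rfl fun z _ => ?_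
        rw [Finset.sum_comm]
        simp only [Finset.mul_sum]
    _ = 0 := by
        refine Finset.sum_eq_zero fun z _ => Finset.sum_eq_zero fun p hp => ?_
        rw [sum_stdAddChar_mul]
        split_ifs with h
        · rw [hX z, zero_mul, zero_mul]
          have hp' := Finset.mem_range.1 hp
          -- A nonzero character sum forces z = 2n - (p + 1). As p < n, this lies in [n, 2n), where
          -- X vanishes; the factor e(l) in front of Q supplies the shift by one.
          have h1 : z = ((n + n - (p + 1) : ℕ) : ZMod (n + n)) := by
            rw [Nat.cast_sub (by omega), ZMod.natCast_self, zero_sub]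
            exact eq_neg_of_add_eq_zero_left h
          rw [h1, ZMod.val_natCast, Nat.mod_eq_of_lt (by omega)]
          omega
        · simp

theorem norm_stdAddChar {N : ℕ} [NeZero N] (z : ZMod N) : ‖(ZMod.stdAddChar z : ℂ)‖ = 1 := by
  rw [ZMod.stdAddChar_apply, Circle.norm_coe]

/-- The chord is 2|sin(πj/N)|, and Jordan's inequality sin t ≥ 2t/π applies because |πj/N| ≤ π/2. -/
theorem le_norm_stdAddChar_sub_one {N : ℕ} [NeZero N] (j : ℤ) (hj : 2 * |j| ≤ N) :
    4 * |(j : ℝ)| / N ≤ ‖(ZMod.stdAddChar (j : ZMod N) : ℂ) - 1‖ := by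
  have hN : (0 : ℝ) < N := by exact_mod_cast NeZero.pos N
  have hj' : 2 * |(j : ℝ)| ≤ N := by exact_mod_cast hj
  have h1 : (ZMod.stdAddChar (j : ZMod N) : ℂ)
      = Complex.exp (Complex.I * ((2 * Real.pi * j / N : ℝ) : ℂ)) := by
    rw [ZMod.stdAddChar_coe]
    congr 1
    push_cast
    ring
  rw [h1, Complex.norm_exp_I_mul_ofReal_sub_one]
  have hpi := Real.pi_pos
  have h2 : |2 * Real.pi * j / N / 2| = Real.pi * |(j : ℝ)| / N := by
    rw [abs_div, abs_div, abs_mul, abs_mul, abs_of_pos hpi, abs_of_pos hN]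
    norm_num
    ring
  have h3 : |2 * Real.pi * (j : ℝ) / N / 2| ≤ Real.pi / 2 := by
    rw [h2, div_le_div_iff₀ hN two_pos]
    nlinarith
  have h4 := Real.mul_abs_le_abs_sin h3
  rw [h2] at h4
  rw [Real.norm_eq_abs, abs_mul, abs_two]
  have h5 : 2 / Real.pi * (Real.pi * |(j : ℝ)| / N) = 2 * |(j : ℝ)| / N := by
    field_simp
  rw [h5] at h4
  calc 4 * |(j : ℝ)| / N = 2 * (2 * |(j : ℝ)| / N) := by ring
    _ ≤ _ := by linarith

/-- The average of the first `L` powers of `w`. -/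
noncomputable def powerMean (L : ℕ) (w : ℂ) : ℂ := (L : ℂ)⁻¹ * ∑ p ∈ Finset.range L, w ^ p

theorem powerMean_one {L : ℕ} (hL : L ≠ 0) : powerMean L 1 = 1 := by
  simp [powerMean, hL]

theorem norm_powerMean_le_one (L : ℕ) {w : ℂ} (hw : ‖w‖ = 1) : ‖powerMean L w‖ ≤ 1 := by
  rcases Nat.eq_zero_or_pos L with rfl | hL
  · simp [powerMean]
  have hL' : (0 : ℝ) < L := by exact_mod_cast hL
  rw [powerMean, norm_mul, norm_inv, Complex.norm_natCast, inv_mul_le_iff₀ hL', mul_one]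
  refine (norm_sum_le _ _).trans ?_
  simp [hw]

theorem norm_powerMean_mul_le (L : ℕ) {w : ℂ} (hw : ‖w‖ = 1) :
    ‖powerMean L w‖ * (L * ‖w - 1‖) ≤ 2 := by
  rcases Nat.eq_zero_or_pos L with rfl | hL
  · simp
  have hL' : (L : ℂ) ≠ 0 := by exact_mod_cast hL.ne'
  have h : powerMean L w * (L * (w - 1)) = w ^ L - 1 := by
    rw [powerMean, ← geom_sum_mul]
    field_simp
  calc ‖powerMean L w‖ * (L * ‖w - 1‖) = ‖w ^ L - 1‖ := by
        rw [← h, norm_mul, norm_mul, Complex.norm_natCast]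
    _ ≤ ‖w ^ L‖ + ‖(1 : ℂ)‖ := norm_sub_le _ _
    _ = 2 := by rw [norm_pow, hw]; norm_num

theorem norm_powerMean_stdAddChar_le {N L : ℕ} [NeZero N] (hL : 0 < L) {z : ZMod N}
    {B : ℝ} (hB : 0 < B) (hz : B ≤ |(z.valMinAbs : ℝ)|) :
    ‖powerMean L (ZMod.stdAddChar z)‖ ≤ N / (2 * L * B) := by
  have hN : (0 : ℝ) < N := by exact_mod_cast NeZero.pos N
  have hL' : (0 : ℝ) < L := by exact_mod_cast hL
  have h1 := norm_powerMean_mul_le L (norm_stdAddChar z)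
  have h2 := le_norm_stdAddChar_sub_one (N := N) z.valMinAbs (by
    have h := ZMod.valMinAbs_mem_Ioc z
    have h1 := h.1
    have h2 := h.2
    have : |z.valMinAbs * 2| ≤ N := abs_le.2 ⟨by linarith, h2⟩
    rw [abs_mul] at this
    simpa [mul_comm] using this)
  rw [ZMod.coe_valMinAbs] at h2
  have h3 : 4 * B / N ≤ ‖(ZMod.stdAddChar z : ℂ) - 1‖ := le_trans (by gcongr) h2
  have h4 : ‖powerMean L (ZMod.stdAddChar z)‖ * (L * (4 * B / N)) ≤ 2 :=
    le_trans (by gcongr) h1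
  rw [le_div_iff₀ (by positivity)]
  rw [mul_div_assoc', mul_div_assoc', div_le_iff₀ hN] at h4
  linarith

theorem sum_zmod_val {N : ℕ} [NeZero N] {β : Type*} [AddCommMonoid β] (g : ℕ → β) :
    ∑ z : ZMod N, g z.val = ∑ i ∈ Finset.range N, g i :=
  Finset.sum_nbij' ZMod.val (fun i => (i : ZMod N))
    (fun z _ => Finset.mem_range.2 (ZMod.val_lt z)) (fun _ _ => Finset.mem_univ _)
    (fun z _ => ZMod.natCast_zmod_val z)
    (fun _ hi => ZMod.val_cast_of_lt (Finset.mem_range.1 hi)) (fun _ _ => rfl)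

/-- As a function of the frequency, the mean of powers is the transform of the normalised indicator
of [0, L), so Parseval gives its exact ℓ² mass. -/
theorem sum_normSq_powerMean {N L : ℕ} [NeZero N] (hL : 0 < L) (hLN : L ≤ N) :
    ∑ j : ZMod N, ‖powerMean L (ZMod.stdAddChar j)‖ ^ 2 = N / L := by
  have hL' : (L : ℝ) ≠ 0 := by exact_mod_cast hL.ne'
  have hfilter : (Finset.range N).filter (· < L) = Finset.range L := by
    ext i; simp; omega
  have h1 : ∀ j : ZMod N, powerMean L (ZMod.stdAddChar j)
      = zmodFourier (fun z : ZMod N => if z.val < L then (L : ℂ)⁻¹ else 0) j := by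
    intro j
    have h := sum_zmod_val (N := N) (fun i => (if i < L then (L : ℂ)⁻¹ else 0)
      * (ZMod.stdAddChar j : ℂ) ^ i)
    rw [zmodFourier, powerMean]
    simp only [ite_mul, zero_mul, ← Finset.sum_filter, hfilter] at h ⊢
    rw [Finset.mul_sum, ← h]
    refine Finset.sum_congr rfl fun z _ => ?_
    rw [← AddChar.map_nsmul_eq_pow, nsmul_eq_mul, ZMod.natCast_zmod_val]
  simp only [h1]
  rw [sum_normSq_zmodFourier]
  have h := sum_zmod_val (N := N) (fun i => ‖(if i < L then (L : ℂ)⁻¹ else 0)‖ ^ 2)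
  rw [h, ← Finset.sum_subset (Finset.range_subset_range.2 hLN)]
  · rw [Finset.sum_congr rfl fun _ hi => by rw [if_pos (Finset.mem_range.1 hi)]]
    simp
    field_simp
  · intro i _ hi
    simp [Finset.mem_range] at hi
    simp [hi]

/-! ### The uncertainty principle. -/

/-- Young's inequality for a convolution on a finite abelian group. -/
theorem sum_sq_convolution_le {G : Type*} [AddCommGroup G] [Fintype G] (h y : G → ℝ)
    (hh : ∀ j, 0 ≤ h j) :
    ∑ k, (∑ l, h (l - k) * y l) ^ 2 ≤ (∑ j, h j) ^ 2 * ∑ l, y l ^ 2 := by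
  have h1 : ∀ k, (∑ l, h (l - k) * y l) ^ 2 ≤ (∑ j, h j) * ∑ l, h (l - k) * y l ^ 2 := by
    intro k
    have h2 : ∑ l, h (l - k) = ∑ j, h j := (Equiv.subRight k).sum_comp h
    rw [← h2]
    exact Finset.sum_sq_le_sum_mul_sum_of_sq_le_mul _ (fun l _ => hh _)
      (fun l _ => mul_nonneg (hh _) (sq_nonneg _)) (fun l _ => (by ring : _ = _).le)
  calc ∑ k, (∑ l, h (l - k) * y l) ^ 2
      ≤ ∑ k, (∑ j, h j) * ∑ l, h (l - k) * y l ^ 2 := Finset.sum_le_sum fun k _ => h1 k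
    _ = (∑ j, h j) ^ 2 * ∑ l, y l ^ 2 := by
      rw [← Finset.mul_sum, Finset.sum_comm, sq, mul_assoc]
      congr 1
      rw [Finset.mul_sum]
      refine Finset.sum_congr rfl fun l _ => ?_
      rw [← Finset.sum_mul]
      congr 1
      exact (Equiv.subLeft l).sum_comp h

/-- A polynomial which, evaluated on the circle, is concentrated near `k` and vanishes at `b`. -/
noncomputable def localizer {N : ℕ} [NeZero N] (L M : ℕ) (k b : ZMod N) : Polynomial ℂ :=
  Polynomial.C ((ZMod.stdAddChar k : ℂ)⁻¹ *
      ((ZMod.stdAddChar k : ℂ) ^ M - (ZMod.stdAddChar b : ℂ) ^ M)⁻¹) *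
    (Polynomial.C (L : ℂ)⁻¹ * ∑ p ∈ Finset.range L,
      (Polynomial.C (ZMod.stdAddChar (-k) : ℂ) * Polynomial.X) ^ p) ^ 4 *
    (Polynomial.X ^ M - Polynomial.C ((ZMod.stdAddChar b : ℂ) ^ M))

theorem natDegree_localizer_le {N : ℕ} [NeZero N] (L M : ℕ) (k b : ZMod N) :
    (localizer L M k b).natDegree ≤ 4 * L + M := by
  have h1 : (Polynomial.C (L : ℂ)⁻¹ * ∑ p ∈ Finset.range L,
      (Polynomial.C (ZMod.stdAddChar (-k) : ℂ) * Polynomial.X) ^ p).natDegree ≤ L := by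
    refine Polynomial.natDegree_C_mul_le _ _ |>.trans ?_
    refine Polynomial.natDegree_sum_le_of_forall_le _ _ fun p hp => ?_
    refine Polynomial.natDegree_pow_le.trans ?_
    have h2 := Polynomial.natDegree_C_mul_le (ZMod.stdAddChar (-k) : ℂ) Polynomial.X
    rw [Polynomial.natDegree_X] at h2
    have := Finset.mem_range.1 hp
    nlinarith
  rw [localizer]
  refine Polynomial.natDegree_mul_le.trans (add_le_add ?_ ?_)
  · refine (Polynomial.natDegree_C_mul_le _ _).trans ?_
    exact Polynomial.natDegree_pow_le.trans (by omega)
  · exact Polynomial.natDegree_X_pow_sub_C.le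

theorem eval_localizer {N : ℕ} [NeZero N] (L M : ℕ) (k b l : ZMod N) :
    (localizer L M k b).eval (ZMod.stdAddChar l : ℂ) =
      (ZMod.stdAddChar k : ℂ)⁻¹ * ((ZMod.stdAddChar k : ℂ) ^ M - (ZMod.stdAddChar b : ℂ) ^ M)⁻¹ *
      powerMean L (ZMod.stdAddChar (l - k)) ^ 4 *
      ((ZMod.stdAddChar l : ℂ) ^ M - (ZMod.stdAddChar b : ℂ) ^ M) := by
  have h : ∀ p : ℕ, ((ZMod.stdAddChar (-k) : ℂ) * ZMod.stdAddChar l) ^ p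
      = (ZMod.stdAddChar (l - k) : ℂ) ^ p := by
    intro p
    rw [← AddChar.map_add_eq_mul, neg_add_eq_sub]
  simp [localizer, powerMean, Polynomial.eval_finsetSum, h]

/-- Two neighbouring characters differ only by order 1/n. Their M-th powers are separated by order
M/n, and M·G ≤ n prevents Mδ from passing half a turn, so the separation cannot be lost by wrapping
around. -/
theorem norm_stdAddChar_pow_sub_pow_ge {n M G : ℕ} [NeZero (n + n)] (hMG : M * G ≤ n)
    (k : ZMod (n + n)) {δ : ℤ} (hδ0 : δ ≠ 0) (hδ : |δ| ≤ G) :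
    2 * (M : ℝ) / n ≤ ‖(ZMod.stdAddChar k : ℂ) ^ M
      - (ZMod.stdAddChar (k + (δ : ZMod (n + n))) : ℂ) ^ M‖ := by
  have h1 : (ZMod.stdAddChar k : ℂ) ^ M - (ZMod.stdAddChar (k + (δ : ZMod (n + n))) : ℂ) ^ M
      = (ZMod.stdAddChar k : ℂ) ^ M *
        (1 - ZMod.stdAddChar (((M : ℤ) * δ : ℤ) : ZMod (n + n))) := by
    rw [AddChar.map_add_eq_mul, mul_pow, mul_sub, mul_one, Int.cast_mul, Int.cast_natCast,
      ← nsmul_eq_mul, AddChar.map_nsmul_eq_pow]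
  have h2 : |(M : ℤ) * δ| ≤ n := by
    rw [abs_mul, Nat.abs_cast]
    calc (M : ℤ) * |δ| ≤ M * G := by gcongr
      _ ≤ n := by exact_mod_cast hMG
  have h3 := le_norm_stdAddChar_sub_one (N := n + n) ((M : ℤ) * δ) (by push_cast; linarith)
  rw [h1, norm_mul, norm_pow, norm_stdAddChar, one_pow, one_mul, norm_sub_rev]
  refine le_trans ?_ h3
  have h4 : (1 : ℝ) ≤ |(δ : ℝ)| := by exact_mod_cast Int.one_le_abs hδ0
  push_cast
  rw [abs_mul, Nat.abs_cast]
  have hn : (0 : ℝ) < n := by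
    have := NeZero.pos (n + n)
    exact_mod_cast (by omega : 0 < n)
  calc 2 * (M : ℝ) / n = 4 * (M * 1) / (n + n) := by field_simp; ring
    _ ≤ 4 * (M * |(δ : ℝ)|) / (n + n) := by gcongr

/-- Uncertainty principle: if `S` is a set of frequencies such that every `k ∈ S` has at most one
other element of `S` within distance `2 ^ 15`, then a function on `ZMod (2n)` supported on half of
the group has a fixed proportion of its Fourier mass outside of `S`. -/
theorem sum_normSq_zmodFourier_le {n : ℕ} [NeZero (n + n)] (hn : 2 ^ 16 ≤ n)
    (X : ZMod (n + n) → ℂ) (hX : ∀ z, n ≤ z.val → X z = 0) (S : Finset (ZMod (n + n)))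
    (hS : ∀ k ∈ S, ∃ δ : ℤ, δ ≠ 0 ∧ |δ| ≤ 2 ^ 15 ∧ ∀ l ∈ S, |(l - k).valMinAbs| ≤ 2 ^ 15 →
      l = k ∨ l = k + δ) :
    ∑ k, ‖zmodFourier X k‖ ^ 2 ≤ 2 ^ 45 * ∑ k ∈ Sᶜ, ‖zmodFourier X k‖ ^ 2 := by
  classical
  -- Degree budget: the fourth power of a mean of length n/8 costs at most n/2, and the zero at the
  -- neighbour costs n/2^15, which together stay below n. Also M·2^15 ≤ n, as the gap estimate
  -- requires.
  set L := n / 8 with hLdef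
  set M := n / 2 ^ 15 with hMdef
  have hL : 0 < L := by omega
  have hL0 : (0 : ℝ) < L := by exact_mod_cast hL
  have hM : 0 < M := by omega
  have hM0 : (0 : ℝ) < M := by exact_mod_cast hM
  have hn0 : (0 : ℝ) < n := by exact_mod_cast (by omega : 0 < n)
  have hLn : (n : ℝ) ≤ 16 * L := by exact_mod_cast (by omega : n ≤ 16 * L)
  have hMn : (n : ℝ) ≤ 2 ^ 16 * M := by exact_mod_cast (by omega : n ≤ 2 ^ 16 * M)
  set D : ZMod (n + n) → ℝ := fun j => ‖powerMean L (ZMod.stdAddChar j)‖ with hD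
  have hD0 : ∀ j, 0 ≤ D j := fun j => norm_nonneg _
  have hD1 : ∀ j, D j ≤ 1 := fun j => norm_powerMean_le_one L (norm_stdAddChar j)
  have hDsum : ∑ j, D j ^ 2 ≤ 32 := by
    simp only [hD]
    rw [sum_normSq_powerMean hL (by omega), div_le_iff₀ hL0]
    push_cast
    linarith
  have hDfar : ∀ j : ZMod (n + n), ¬ |j.valMinAbs| ≤ 2 ^ 15 → D j ≤ 1 / 2 ^ 11 := by
    intro j hj
    have hj' : (2 ^ 15 : ℝ) ≤ |(j.valMinAbs : ℝ)| := by exact_mod_cast (not_le.1 hj).le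
    refine (norm_powerMean_stdAddChar_le hL (by norm_num) hj').trans ?_
    rw [div_le_div_iff₀ (by positivity) (by norm_num)]
    push_cast
    linarith
  -- H majorises the test polynomial: 2^15 bounds the inverse gap and 2 the factor vanishing at the
  -- neighbour. F is the part of H at distance more than 2^15.
  set H : ZMod (n + n) → ℝ := fun j => 2 ^ 16 * D j ^ 4 with hH
  set F : ZMod (n + n) → ℝ := fun j => if |j.valMinAbs| ≤ 2 ^ 15 then 0 else H j with hF
  have hH0 : ∀ j, 0 ≤ H j := fun j => by positivity
  have hF0 : ∀ j, 0 ≤ F j := fun j => by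
    simp only [hF]; split_ifs <;> [exact le_rfl; exact hH0 j]
  have hHsum : ∑ j, H j ≤ 2 ^ 21 := by
    calc ∑ j, H j ≤ ∑ j, 2 ^ 16 * D j ^ 2 := by
          refine Finset.sum_le_sum fun j _ => ?_
          have := pow_le_pow_of_le_one (hD0 j) (hD1 j) (show 2 ≤ 4 by norm_num)
          simp only [hH]
          linarith
      _ ≤ 2 ^ 21 := by rw [← Finset.mul_sum]; linarith
  -- The fourth power pays for the normalisation: two of the four factors are at most 2^{-11} far
  -- away, the other two sum to at most 32, and 2^16 · 2^{-22} · 32 = 1/2.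
  have hFsum : ∑ j, F j ≤ 1 / 2 := by
    calc ∑ j, F j ≤ ∑ j, 1 / 2 ^ 6 * D j ^ 2 := by
          refine Finset.sum_le_sum fun j _ => ?_
          simp only [hF]
          split_ifs with h
          · have := hD0 j; positivity
          · have h1 : D j ^ 2 ≤ (1 / 2 ^ 11) ^ 2 := pow_le_pow_left₀ (hD0 j) (hDfar j h) 2
            have h2 : D j ^ 4 ≤ (1 / 2 ^ 11) ^ 2 * D j ^ 2 := by
              calc D j ^ 4 = D j ^ 2 * D j ^ 2 := by ring
                _ ≤ _ := by gcongr
            simp only [hH]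
            norm_num at h2 ⊢
            linarith
      _ ≤ 1 / 2 := by rw [← Finset.mul_sum]; linarith
  set y : ZMod (n + n) → ℝ := fun k => ‖zmodFourier X k‖ with hy
  set z : ZMod (n + n) → ℝ := fun k => if k ∈ S then 0 else y k with hz
  have hy0 : ∀ k, 0 ≤ y k := fun k => norm_nonneg _
  -- Orthogonality is solved for the term at k, where the test polynomial equals 1. The only other
  -- nearby element of S is b, where it vanishes; so elements of S enter through F only, and the
  -- rest through H.
  have hpoint : ∀ k ∈ S, y k ≤ ∑ l, F (l - k) * y l + ∑ l, H (l - k) * z l := by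
    intro k hk
    obtain ⟨δ, hδ0, hδ, hb⟩ := hS k hk
    set b : ZMod (n + n) := k + δ with hbdef
    have hgap := norm_stdAddChar_pow_sub_pow_ge (M := M) (G := 2 ^ 15)
      (Nat.div_mul_le_self n (2 ^ 15)) k hδ0 (by exact_mod_cast hδ)
    rw [← hbdef] at hgap
    have hgap0 : (0 : ℝ) < 2 * M / n := by positivity
    set Pl : ZMod (n + n) → ℂ := fun l =>
      ZMod.stdAddChar l * (localizer L M k b).eval (ZMod.stdAddChar l : ℂ) with hPl
    have horth : ∑ l, zmodFourier X l * Pl l = 0 :=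
      sum_zmodFourier_mul_eval_eq_zero X hX _
        ((natDegree_localizer_le L M k b).trans_lt (by omega))
    have hPk : Pl k = 1 := by
      have h1 : (ZMod.stdAddChar k : ℂ) ^ M - (ZMod.stdAddChar b : ℂ) ^ M ≠ 0 := by
        rw [← norm_pos_iff]; linarith
      have h2 : (ZMod.stdAddChar k : ℂ) ≠ 0 := by
        rw [← norm_pos_iff, norm_stdAddChar]; norm_num
      simp only [hPl, eval_localizer, sub_self, AddChar.map_zero_eq_one, powerMean_one hL.ne']
      field_simp
    have hPb : Pl b = 0 := by simp [hPl, eval_localizer]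
    have hPle : ∀ l, ‖Pl l‖ ≤ H (l - k) := by
      intro l
      simp only [hPl, eval_localizer, norm_mul, norm_inv, norm_pow, norm_stdAddChar, one_mul,
        inv_one]
      have h1 : ‖(ZMod.stdAddChar l : ℂ) ^ M - (ZMod.stdAddChar b : ℂ) ^ M‖ ≤ 2 := by
        refine (norm_sub_le _ _).trans ?_
        simp only [norm_pow, norm_stdAddChar, one_pow]
        norm_num
      have h2 : ‖(ZMod.stdAddChar k : ℂ) ^ M - (ZMod.stdAddChar b : ℂ) ^ M‖⁻¹ ≤ 2 ^ 15 := by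
        refine (inv_anti₀ hgap0 hgap).trans ?_
        rw [inv_div, div_le_iff₀ (by positivity)]
        linarith
      calc _ ≤ 2 ^ 15 * D (l - k) ^ 4 * 2 := by
            simp only [hD]
            gcongr
        _ = H (l - k) := by simp only [hH]; ring
    have hyk : y k = ‖∑ l ∈ Finset.univ.erase k, zmodFourier X l * Pl l‖ := by
      rw [← Finset.add_sum_erase _ _ (Finset.mem_univ k), hPk, mul_one] at horth
      rw [← norm_neg, ← eq_neg_of_add_eq_zero_left horth]
    rw [hyk, ← Finset.sum_add_distrib]
    refine (norm_sum_le _ _).trans ?_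
    refine (Finset.sum_le_sum (g := fun l => F (l - k) * y l + H (l - k) * z l)
      fun l hl => ?_).trans ?_
    · have hlk := Finset.ne_of_mem_erase hl
      rw [norm_mul]
      have hF' := mul_nonneg (hF0 (l - k)) (hy0 l)
      by_cases hlS : l ∈ S
      · simp only [hz, if_pos hlS, mul_zero, add_zero]
        by_cases hnear : |(l - k).valMinAbs| ≤ 2 ^ 15
        · rcases hb l hlS hnear with h | h
          · exact absurd h hlk
          · rw [h, hPb, norm_zero, mul_zero, ← h]
            exact hF'
        · simp only [hF, if_neg hnear]
          rw [mul_comm]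
          exact mul_le_mul_of_nonneg_right (hPle l) (hy0 l)
      · simp only [hz, if_neg hlS]
        rw [mul_comm]
        have := mul_le_mul_of_nonneg_right (hPle l) (hy0 l)
        linarith
    · refine Finset.sum_le_sum_of_subset_of_nonneg (Finset.erase_subset _ _) fun l _ _ => ?_
      refine add_nonneg (mul_nonneg (hF0 _) (hy0 _)) (mul_nonneg (hH0 _) ?_)
      simp only [hz]; split_ifs <;> [exact le_rfl; exact hy0 l]
  have hsplit : ∑ k, y k ^ 2 = ∑ k ∈ S, y k ^ 2 + ∑ k ∈ Sᶜ, y k ^ 2 :=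
    (Finset.sum_add_sum_compl S _).symm
  have hzsum : ∑ k, z k ^ 2 = ∑ k ∈ Sᶜ, y k ^ 2 := by
    rw [← Finset.sum_add_sum_compl S]
    rw [Finset.sum_eq_zero (s := S) fun k hk => by simp [hz, hk], zero_add]
    refine Finset.sum_congr rfl fun k hk => ?_
    simp [hz, Finset.mem_compl.1 hk]
  have hSsum : ∑ k ∈ S, y k ^ 2 ≤
      2 * ((∑ j, F j) ^ 2 * ∑ l, y l ^ 2) + 2 * ((∑ j, H j) ^ 2 * ∑ l, z l ^ 2) := by
    calc ∑ k ∈ S, y k ^ 2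
        ≤ ∑ k ∈ S, (2 * (∑ l, F (l - k) * y l) ^ 2 + 2 * (∑ l, H (l - k) * z l) ^ 2) := by
          refine Finset.sum_le_sum fun k hk => ?_
          have h1 := pow_le_pow_left₀ (hy0 k) (hpoint k hk) 2
          have h2 := add_sq_le (a := ∑ l, F (l - k) * y l) (b := ∑ l, H (l - k) * z l)
          linarith
      _ ≤ ∑ k, (2 * (∑ l, F (l - k) * y l) ^ 2 + 2 * (∑ l, H (l - k) * z l) ^ 2) :=
          Finset.sum_le_sum_of_subset_of_nonneg (Finset.subset_univ _)
            fun k _ _ => by positivity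
      _ ≤ _ := by
          rw [Finset.sum_add_distrib, ← Finset.mul_sum, ← Finset.mul_sum]
          gcongr
          · exact sum_sq_convolution_le F y hF0
          · exact sum_sq_convolution_le H z hH0
  have hy2 : 0 ≤ ∑ l, y l ^ 2 := Finset.sum_nonneg fun l _ => sq_nonneg _
  have hz2 : 0 ≤ ∑ k ∈ Sᶜ, y k ^ 2 := Finset.sum_nonneg fun l _ => sq_nonneg _
  -- The F-term contributes 2 · (1/2)² = 1/2 of the whole mass and is absorbed on the left; the
  -- H-term leaves 2 · 2^42 and hence the factor 2^45.
  have hF2 : (∑ j, F j) ^ 2 ≤ (1 / 2) ^ 2 :=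
    pow_le_pow_left₀ (Finset.sum_nonneg fun j _ => hF0 j) hFsum 2
  have hH2 : (∑ j, H j) ^ 2 ≤ (2 ^ 21) ^ 2 :=
    pow_le_pow_left₀ (Finset.sum_nonneg fun j _ => hH0 j) hHsum 2
  rw [hzsum] at hSsum
  have h1 := mul_le_mul_of_nonneg_right hF2 hy2
  have h2 := mul_le_mul_of_nonneg_right hH2 hz2
  change ∑ k, y k ^ 2 ≤ 2 ^ 45 * ∑ k ∈ Sᶜ, y k ^ 2
  norm_num at h1 h2 ⊢
  linarith

/-! ### Diagonalising the circulant embedding. -/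

/-- The symbol of the circulant matrix `[T_n, B_n; B_n, T_n]`. -/
noncomputable def circulantSymbol (n : ℕ) (a : ℤ → ℝ) (s : ℝ) (w : ZMod (n + n)) : ℝ :=
  if w.valMinAbs = n then s else a w.valMinAbs

/-- The position of a row of `stackedToeplitz` in the circulant matrix. -/
def rowIndex (n : ℕ) : Fin n ⊕ Fin n → ZMod (n + n) :=
  Sum.elim (fun i => ((i : ℕ) : ZMod (n + n))) (fun i => ((n + i : ℕ) : ZMod (n + n)))

theorem rowIndex_bijective (n : ℕ) [NeZero (n + n)] : Function.Bijective (rowIndex n) := by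
  rw [Fintype.bijective_iff_injective_and_card]
  refine ⟨?_, by simp [ZMod.card]⟩
  have key : ∀ p q : ℕ, p < n + n → q < n + n → ((p : ZMod (n + n)) = q) → p = q := by
    intro p q hp hq h
    rw [← ZMod.val_cast_of_lt hp, ← ZMod.val_cast_of_lt hq, h]
  rintro (i | i) (j | j) h <;> have hi := i.2 <;> have hj := j.2 <;>
    have := key _ _ (by omega) (by omega) h
  · exact congrArg Sum.inl (Fin.ext this)
  · omega
  · omega
  · exact congrArg Sum.inr (Fin.ext (by omega))

/-- Representatives are taken in (-n, n], so the class of n, which is the diagonal of the lower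
block, is represented by n itself; this is the entry that carries s. -/
theorem stackedToeplitz_apply (n : ℕ) [NeZero (n + n)] (a : ℤ → ℝ) (s : ℝ)
    (p : Fin n ⊕ Fin n) (q : Fin n) :
    stackedToeplitz n a s p q
      = circulantSymbol n a s (((q : ℕ) : ZMod (n + n)) - rowIndex n p) := by
  have hq := q.2
  have key : ∀ (w : ZMod (n + n)) (y : ℤ), w = (y : ZMod (n + n)) → -n < y → y ≤ n →
      w.valMinAbs = y := by
    intro w y hw h1 h2
    rw [ZMod.valMinAbs_spec]
    refine ⟨hw, ?_, ?_⟩ <;> push_cast <;> linarith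
  rcases p with i | i
  · have hi := i.2
    have h := key (((q : ℕ) : ZMod (n + n)) - rowIndex n (Sum.inl i)) ((q : ℤ) - i)
      (by simp [rowIndex]) (by omega) (by omega)
    rw [circulantSymbol, h, if_neg (by omega)]
    rfl
  · have hi := i.2
    have hnn : (n : ZMod (n + n)) + n = 0 := by
      have := ZMod.natCast_self (n + n)
      rwa [Nat.cast_add] at this
    change embeddingBlock n a s i q = _
    simp only [embeddingBlock, Matrix.of_apply]
    rcases lt_trichotomy i q with hlt | heq | hgt
    · have hlt' : (i : ℕ) < q := hlt
      have h := key (((q : ℕ) : ZMod (n + n)) - rowIndex n (Sum.inr i)) ((q : ℤ) - i - n)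
        (by simp [rowIndex]; ring) (by omega) (by omega)
      rw [circulantSymbol, h, if_neg hlt.ne, if_pos hlt, if_neg (by omega)]
    · have h := key (((q : ℕ) : ZMod (n + n)) - rowIndex n (Sum.inr i)) n
        (by
          simp only [rowIndex, Sum.elim_inr, heq, Nat.cast_add, Int.cast_natCast]
          linear_combination -hnn) (by omega) (by omega)
      rw [circulantSymbol, h, if_pos heq, if_pos rfl]
    · have hgt' : (q : ℕ) < i := hgt
      have h := key (((q : ℕ) : ZMod (n + n)) - rowIndex n (Sum.inr i)) (n + (q : ℤ) - i)
        (by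
          simp only [rowIndex, Sum.elim_inr, Nat.cast_add, Int.cast_natCast, Int.cast_add,
            Int.cast_sub]
          linear_combination -hnn) (by omega) (by omega)
      rw [circulantSymbol, h, if_neg hgt.ne', if_neg hgt.not_gt, if_neg (by omega)]

/-- The eigenvalues of the circulant matrix `[T_n, B_n; B_n, T_n]`. -/
noncomputable def circulantEigenvalue (n : ℕ) [NeZero (n + n)] (a : ℤ → ℝ) (s : ℝ)
    (k : ZMod (n + n)) : ℂ :=
  ∑ w, (circulantSymbol n a s w : ℂ) * ZMod.stdAddChar (-(w * k))

/-- Extension of a vector by zero to `ZMod (2n)`. -/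
noncomputable def zeroExtend {n : ℕ} (x : EuclideanSpace ℝ (Fin n)) (z : ZMod (n + n)) : ℂ :=
  if h : z.val < n then ((x ⟨z.val, h⟩ : ℝ) : ℂ) else 0

theorem zeroExtend_of_le {n : ℕ} (x : EuclideanSpace ℝ (Fin n)) (z : ZMod (n + n))
    (hz : n ≤ z.val) : zeroExtend x z = 0 := by
  rw [zeroExtend, dif_neg (by omega)]

theorem zeroExtend_natCast {n : ℕ} (x : EuclideanSpace ℝ (Fin n)) (q : Fin n) :
    zeroExtend x ((q : ℕ) : ZMod (n + n)) = x q := by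
  have hq := q.2
  have h : (((q : ℕ) : ZMod (n + n))).val = q := ZMod.val_cast_of_lt (by omega)
  simp [zeroExtend, h]

theorem sum_zmod_eq_sum_fin {n : ℕ} [NeZero (n + n)] {β : Type*} [AddCommMonoid β]
    (g : ZMod (n + n) → β) (hg : ∀ z, n ≤ z.val → g z = 0) :
    ∑ z, g z = ∑ q : Fin n, g ((q : ℕ) : ZMod (n + n)) := by
  have hval : ∀ q : Fin n, (((q : ℕ) : ZMod (n + n))).val = q := fun q => by
    have hq := q.2
    exact ZMod.val_cast_of_lt (by omega)
  refine (Finset.sum_of_injOn (fun q : Fin n => ((q : ℕ) : ZMod (n + n))) ?_ (by simp) ?_ ?_).symm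
  · intro p _ q _ h
    have := congrArg ZMod.val h
    simp only [hval] at this
    exact Fin.ext this
  · intro z _ hz
    refine hg z ?_
    by_contra hlt
    exact hz ⟨⟨z.val, by omega⟩, by simp, by simp⟩
  · intro q _
    rfl

theorem sum_normSq_zmodFourier_zeroExtend {n : ℕ} [NeZero (n + n)]
    (x : EuclideanSpace ℝ (Fin n)) :
    ∑ k, ‖zmodFourier (zeroExtend x) k‖ ^ 2 = ((n + n : ℕ) : ℝ) * ‖x‖ ^ 2 := by
  rw [sum_normSq_zmodFourier, sum_zmod_eq_sum_fin _
    (fun z hz => by rw [zeroExtend_of_le x z hz]; simp), EuclideanSpace.norm_sq_eq]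
  simp only [zeroExtend_natCast, Complex.norm_real]

/-- Up to reordering rows, A x is the correlation of the symbol with the zero extension of x. Its
transform is therefore the product of the eigenvalue and x̂, and Parseval concludes. -/
theorem sum_normSq_eigenvalue_mul {n : ℕ} [NeZero (n + n)] (a : ℤ → ℝ) (s : ℝ)
    (x : EuclideanSpace ℝ (Fin n)) :
    ∑ k, ‖circulantEigenvalue n a s k‖ ^ 2 * ‖zmodFourier (zeroExtend x) k‖ ^ 2
      = ((n + n : ℕ) : ℝ) * ‖Matrix.toEuclideanLin (stackedToeplitz n a s) x‖ ^ 2 := by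
  set Y : ZMod (n + n) → ℂ := fun z =>
    ∑ q : Fin n, (circulantSymbol n a s (((q : ℕ) : ZMod (n + n)) - z) : ℂ) * (x q : ℂ) with hY
  have h1 : ∀ k, zmodFourier Y k
      = circulantEigenvalue n a s k * zmodFourier (zeroExtend x) k := by
    intro k
    have h2 : zmodFourier (zeroExtend x) k
        = ∑ q : Fin n, (x q : ℂ) * ZMod.stdAddChar (((q : ℕ) : ZMod (n + n)) * k) := by
      rw [zmodFourier, sum_zmod_eq_sum_fin _
        (fun z hz => by rw [zeroExtend_of_le x z hz, zero_mul])]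
      simp only [zeroExtend_natCast]
    rw [h2, Finset.mul_sum]
    simp only [zmodFourier, hY, Finset.sum_mul]
    rw [Finset.sum_comm]
    refine Finset.sum_congr rfl fun q _ => ?_
    rw [circulantEigenvalue, Finset.sum_mul,
      ← (Equiv.subLeft ((q : ℕ) : ZMod (n + n))).sum_comp]
    refine Finset.sum_congr rfl fun w _ => ?_
    simp only [Equiv.subLeft_apply, sub_sub_cancel]
    rw [sub_mul, sub_eq_neg_add, AddChar.map_add_eq_mul]
    ring
  have h3 : ‖Matrix.toEuclideanLin (stackedToeplitz n a s) x‖ ^ 2 = ∑ z, ‖Y z‖ ^ 2 := by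
    rw [EuclideanSpace.norm_sq_eq, ← (rowIndex_bijective n).sum_comp]
    refine Finset.sum_congr rfl fun p _ => ?_
    have h4 : Y (rowIndex n p)
        = ((Matrix.toEuclideanLin (stackedToeplitz n a s) x p : ℝ) : ℂ) := by
      simp only [hY, Matrix.toLpLin_apply, Matrix.mulVec, dotProduct, stackedToeplitz_apply]
      push_cast
      rfl
    rw [h4, Complex.norm_real]
  rw [h3, ← sum_normSq_zmodFourier]
  simp only [h1, norm_mul, mul_pow]

theorem norm_toEuclideanLin_stackedToeplitz_le {n : ℕ} [NeZero (n + n)] (a : ℤ → ℝ) (s : ℝ)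
    {R : ℝ} (hR : 0 ≤ R) (h : ∀ k, ‖circulantEigenvalue n a s k‖ ≤ R)
    (x : EuclideanSpace ℝ (Fin n)) :
    ‖Matrix.toEuclideanLin (stackedToeplitz n a s) x‖ ≤ R * ‖x‖ := by
  have hN : (0 : ℝ) < ((n + n : ℕ) : ℝ) := by exact_mod_cast NeZero.pos (n + n)
  refine le_of_sq_le_sq ?_ (by positivity)
  refine le_of_mul_le_mul_left ?_ hN
  rw [← sum_normSq_eigenvalue_mul, mul_pow, mul_left_comm, ← sum_normSq_zmodFourier_zeroExtend,
    Finset.mul_sum]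
  refine Finset.sum_le_sum fun k _ => ?_
  gcongr
  exact h k

theorem le_norm_toEuclideanLin_stackedToeplitz {n : ℕ} [NeZero (n + n)] (a : ℤ → ℝ) (s : ℝ)
    {c : ℝ} (hc : 0 ≤ c) (h : ∀ k, c ≤ ‖circulantEigenvalue n a s k‖)
    (x : EuclideanSpace ℝ (Fin n)) :
    c * ‖x‖ ≤ ‖Matrix.toEuclideanLin (stackedToeplitz n a s) x‖ := by
  have hN : (0 : ℝ) < ((n + n : ℕ) : ℝ) := by exact_mod_cast NeZero.pos (n + n)
  refine le_of_sq_le_sq ?_ (norm_nonneg _)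
  refine le_of_mul_le_mul_left ?_ hN
  rw [← sum_normSq_eigenvalue_mul, mul_pow, mul_left_comm, ← sum_normSq_zmodFourier_zeroExtend,
    Finset.mul_sum]
  refine Finset.sum_le_sum fun k _ => ?_
  gcongr
  exact h k

/-- If small eigenvalues of the circulant matrix form no clusters of three, then the smallest
singular value of `stackedToeplitz` is bounded below. -/
theorem le_norm_toEuclideanLin_of_no_cluster {n : ℕ} [NeZero (n + n)] (hn : 2 ^ 16 ≤ n)
    (a : ℤ → ℝ) (s : ℝ)
    (hS : ∀ k, ‖circulantEigenvalue n a s k‖ ≤ 1 → ∃ δ : ℤ, δ ≠ 0 ∧ |δ| ≤ 2 ^ 15 ∧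
      ∀ l, ‖circulantEigenvalue n a s l‖ ≤ 1 → |(l - k).valMinAbs| ≤ 2 ^ 15 →
        l = k ∨ l = k + δ)
    (x : EuclideanSpace ℝ (Fin n)) :
    (2 ^ 23 : ℝ)⁻¹ * ‖x‖ ≤ ‖Matrix.toEuclideanLin (stackedToeplitz n a s) x‖ := by
  classical
  have hN : (0 : ℝ) < ((n + n : ℕ) : ℝ) := by exact_mod_cast NeZero.pos (n + n)
  -- Off S the weight |λ_k|² exceeds 1, so the mass of x̂ there is bounded by the weighted sum that
  -- equals 2n‖A x‖².
  set S : Finset (ZMod (n + n)) :=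
    Finset.univ.filter fun k => ‖circulantEigenvalue n a s k‖ ≤ 1 with hSdef
  have h1 := sum_normSq_zmodFourier_le hn (zeroExtend x) (zeroExtend_of_le x) S
    (by simpa [hSdef] using hS)
  have h2 : ∑ k ∈ Sᶜ, ‖zmodFourier (zeroExtend x) k‖ ^ 2 ≤
      ∑ k, ‖circulantEigenvalue n a s k‖ ^ 2 * ‖zmodFourier (zeroExtend x) k‖ ^ 2 := by
    refine (Finset.sum_le_sum fun k hk => ?_).trans
      (Finset.sum_le_sum_of_subset_of_nonneg (Finset.subset_univ Sᶜ) fun k _ _ => by positivity)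
    have hk' : 1 < ‖circulantEigenvalue n a s k‖ := by simpa [hSdef] using hk
    exact le_mul_of_one_le_left (sq_nonneg _) (one_le_pow₀ hk'.le)
  rw [sum_normSq_eigenvalue_mul] at h2
  rw [sum_normSq_zmodFourier_zeroExtend] at h1
  refine le_of_sq_le_sq ?_ (norm_nonneg _)
  refine le_of_mul_le_mul_left ?_ hN
  have h0 : 0 ≤ ((n + n : ℕ) : ℝ) * ‖x‖ ^ 2 := by positivity
  rw [mul_pow]
  norm_num at h1 h2 h0 ⊢
  linarith

/-- The entry s sits at d = n, where the sine vanishes, so it affects the real part only and with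
constant modulus |s|. -/
theorem circulantEigenvalue_intCast {n : ℕ} [NeZero (n + n)] (a : ℤ → ℝ) (s : ℝ) (k : ℤ) :
    circulantEigenvalue n a s (k : ZMod (n + n)) =
      ((∑ d ∈ Finset.Ioo (-(n : ℤ)) n, a d * Real.cos (Real.pi * d * k / n)
          + s * Real.cos (Real.pi * k) : ℝ) : ℂ)
        - ((∑ d ∈ Finset.Ioo (-(n : ℤ)) n, a d * Real.sin (Real.pi * d * k / n) : ℝ) : ℂ)
          * Complex.I := by
  have hn : 0 < n := by
    have := NeZero.pos (n + n)
    omega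
  have hchar : ∀ d : ℤ, (ZMod.stdAddChar (-((d : ZMod (n + n)) * (k : ZMod (n + n)))) : ℂ)
      = (Real.cos (Real.pi * d * k / n) : ℂ) - (Real.sin (Real.pi * d * k / n) : ℂ) * Complex.I := by
    intro d
    have h1 : (-((d : ZMod (n + n)) * (k : ZMod (n + n)))) = ((-(d * k) : ℤ) : ZMod (n + n)) := by
      push_cast; ring
    rw [h1, ZMod.stdAddChar_coe]
    have h2 : 2 * Real.pi * Complex.I * ((-(d * k) : ℤ) : ℂ) / ((n + n : ℕ) : ℂ)
        = ((-(Real.pi * d * k / n) : ℝ) : ℂ) * Complex.I := by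
      have : (n : ℂ) ≠ 0 := by exact_mod_cast hn.ne'
      push_cast
      field_simp
      ring
    rw [h2, Complex.exp_mul_I, ← Complex.ofReal_cos, ← Complex.ofReal_sin, Real.cos_neg,
      Real.sin_neg]
    push_cast
    ring
  have hmem : ∀ d ∈ Finset.Ioc (-(n : ℤ)) n, ((d : ZMod (n + n))).valMinAbs = d := by
    intro d hd
    rw [Finset.mem_Ioc] at hd
    rw [ZMod.valMinAbs_spec]
    refine ⟨rfl, ?_, ?_⟩ <;> push_cast <;> linarith
  have hsum : circulantEigenvalue n a s (k : ZMod (n + n)) =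
      ∑ d ∈ Finset.Ioc (-(n : ℤ)) n, (((if d = n then s else a d) : ℝ) : ℂ) *
        ((Real.cos (Real.pi * d * k / n) : ℂ)
          - (Real.sin (Real.pi * d * k / n) : ℂ) * Complex.I) := by
    refine Finset.sum_nbij' ZMod.valMinAbs (fun d : ℤ => (d : ZMod (n + n))) ?_ (by simp)
      (by simp) hmem ?_
    · intro w _
      have := ZMod.valMinAbs_mem_Ioc w
      rw [Set.mem_Ioc] at this
      rw [Finset.mem_Ioc]
      push_cast at this
      omega
    · intro w _
      rw [← hchar, ZMod.coe_valMinAbs]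
      rfl
  have hIoc : Finset.Ioc (-(n : ℤ)) n = insert (n : ℤ) (Finset.Ioo (-(n : ℤ)) n) := by
    ext d
    simp only [Finset.mem_Ioc, Finset.mem_insert, Finset.mem_Ioo]
    omega
  have hn' : (n : ℝ) ≠ 0 := by exact_mod_cast hn.ne'
  have hk : Real.pi * ((n : ℤ) : ℝ) * k / n = k * Real.pi := by
    push_cast
    field_simp
  rw [hsum, hIoc, Finset.sum_insert (by simp), if_pos rfl, hk, Real.sin_int_mul_pi,
    Finset.sum_congr rfl fun d hd => by
      rw [if_neg (by rw [Finset.mem_Ioo] at hd; omega : ¬ d = (n : ℤ)), mul_sub],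
    Finset.sum_sub_distrib, mul_comm Real.pi (k : ℝ)]
  push_cast
  rw [Finset.sum_mul]
  simp only [mul_assoc]
  ring

/-! ### Small ball estimates through characteristic functions. -/

/-- A centred law with finite positive variance has a characteristic function with Gaussian decay
near the origin. -/
theorem exists_norm_charFun_le (μ : Measure ℝ) [IsProbabilityMeasure μ] (hL2 : MemLp id 2 μ)
    (hmean : ∫ x, x ∂μ = 0) (hvar : 0 < variance id μ) :
    ∃ c r : ℝ, 0 < c ∧ 0 < r ∧ ∀ t : ℝ, |t| ≤ r → ‖charFun μ t‖ ≤ Real.exp (-c * t ^ 2) := by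
  set v := ∫ x, x ^ 2 ∂μ with hv
  have hvpos : 0 < v := by
    rw [variance_eq_sub hL2] at hvar
    simpa [hmean] using hvar
  have hT : (fun t ↦ charFun μ t - (1 - v * t ^ 2 / 2)) =o[𝓝 0] fun t ↦ t ^ 2 := by
    have h1 : ∀ t, taylorWithinEval (charFun μ) 2 Set.univ 0 t = ((1 - v * t ^ 2 / 2 : ℝ) : ℂ) := by
      intro t
      have h2 := taylorWithinEval_charFun_two_zero (P := μ) (X := id) aemeasurable_id
        (by simpa using hL2) t
      rw [Measure.map_id] at h2
      rw [h2]
      simp [hmean, hv]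
    have h3 := taylor_isLittleO_univ (f := charFun μ) (x₀ := 0) (n := 2) (contDiff_charFun hL2)
    simp only [h1] at h3
    convert! h3 using 2
    · push_cast; ring
    · simp
  have h4 := hT.bound (show 0 < v / 4 by positivity)
  obtain ⟨r, hr, hball⟩ := Metric.eventually_nhds_iff.1 h4
  -- The second radius forces v t² ≤ 1, which keeps the Taylor polynomial 1 - v t²/2 positive; the
  -- remainder, at most v t²/4, takes half of the decay.
  refine ⟨v / 4, min (r / 2) (1 / (v + 1)), by positivity, by positivity, fun t ht => ?_⟩
  have ht1 : |t| < r := by linarith [ht.trans (min_le_left _ _)]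
  have ht2 : |t| ≤ 1 / (v + 1) := ht.trans (min_le_right _ _)
  have h5 := hball (y := t) (by simpa using ht1)
  have h6 : v * t ^ 2 ≤ 1 := by
    rw [← sq_abs]
    have : (v + 1) * |t| ≤ 1 := by
      rw [le_div_iff₀ (by positivity)] at ht2
      linarith
    nlinarith [abs_nonneg t]
  have h7 : ‖((1 - v * t ^ 2 / 2 : ℝ) : ℂ)‖ = 1 - v * t ^ 2 / 2 := by
    rw [Complex.norm_real, Real.norm_eq_abs, abs_of_nonneg (by linarith)]
  have h8 : charFun μ t = (charFun μ t - (1 - v * t ^ 2 / 2)) + ((1 - v * t ^ 2 / 2 : ℝ) : ℂ) := by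
    push_cast; ring
  have h9 : ‖((t : ℝ) : ℝ) ^ 2‖ = t ^ 2 := by simp
  rw [h9] at h5
  calc ‖charFun μ t‖ ≤ v / 4 * t ^ 2 + (1 - v * t ^ 2 / 2) := by
        rw [h8]
        refine (norm_add_le _ _).trans (add_le_add h5 ?_)
        rw [h7]
    _ = -(v / 4) * t ^ 2 + 1 := by ring
    _ ≤ _ := Real.add_one_le_exp _

theorem integral_exp_neg_mul_sq_sub_le {β η : ℝ} (hβ : 0 < β) (y : ℝ) :
    ∫ x in Set.Icc (-η) η, Real.exp (-β * (x - y) ^ 2) ≤ √(Real.pi / β) := by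
  rw [← integral_gaussian β, ← integral_sub_right_eq_self (fun x => Real.exp (-β * x ^ 2)) y]
  exact setIntegral_le_integral ((integrable_exp_neg_mul_sq hβ).comp_sub_right y)
    (ae_of_all _ fun x => (Real.exp_pos _).le)

/-- Small ball estimate for a random vector whose characteristic function is dominated by a
Gaussian on a box. -/
theorem prob_le_of_charFun_le {Ω : Type*} [MeasurableSpace Ω] (P : Measure Ω)
    [IsProbabilityMeasure P] {d : ℕ} (Y : Ω → Fin d → ℝ) (hY : Measurable Y) {η β : ℝ}
    (hη : 0 < η) (hηd : d * η ≤ 1) (hβ : 0 < β)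
    (hchar : ∀ t : Fin d → ℝ, (∀ i, |t i| ≤ 2 * η) →
      ‖∫ ω, Complex.exp (((∑ i, t i * Y ω i : ℝ) : ℂ) * Complex.I) ∂P‖
        ≤ ∏ i, Real.exp (-β * t i ^ 2)) :
    P.real {ω | ∀ i, |Y ω i| ≤ 1} ≤ 4 / (2 * η) ^ d * √(Real.pi / β) ^ d := by
  set ν : Measure (Fin d → ℝ) := Measure.pi fun _ => volume.restrict (Set.Icc (-η) η) with hν
  have hνr : ν = volume.restrict (Set.univ.pi fun _ => Set.Icc (-η) η) := by
    rw [hν, volume_pi, Measure.restrict_pi_pi]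
  have hνmem : ∀ᵐ u ∂ν, ∀ i, |u i| ≤ η := by
    rw [hνr]
    refine (ae_restrict_iff' (MeasurableSet.univ_pi fun _ => measurableSet_Icc)).2
      (ae_of_all _ fun u hu i => abs_le.2 (hu i trivial))
  set V : ℝ := (2 * η) ^ d with hV
  have hVpos : 0 < V := by positivity
  have hνV : ν.real Set.univ = V := by
    rw [hν, Measure.real, Measure.pi_univ, ENNReal.toReal_prod]
    simp [hV, hη.le]
    ring
  set e : (Fin d → ℝ) → Ω → ℂ := fun u ω =>
    Complex.exp (((∑ i, u i * Y ω i : ℝ) : ℂ) * Complex.I) with he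
  have henorm : ∀ u ω, ‖e u ω‖ = 1 := fun u ω => Complex.norm_exp_ofReal_mul_I _
  have hYi : ∀ i, Measurable fun ω => Y ω i := fun i => (measurable_pi_apply i).comp hY
  have hemeas : Measurable fun q : (Fin d → ℝ) × Ω => e q.1 q.2 := by
    have : Measurable fun q : (Fin d → ℝ) × Ω => (∑ i, q.1 i * Y q.2 i : ℝ) := by
      refine Finset.measurable_sum _ fun i _ => ?_
      exact ((measurable_pi_apply i).comp measurable_fst).mul ((hYi i).comp measurable_snd)
    exact Complex.measurable_exp.comp ((Complex.measurable_ofReal.comp this).mul_const _)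
  -- F replaces the indicator of the event, as in Esseen's inequality: |F| ≥ V/2 there because |u·Y|
  -- ≤ dη ≤ 1, while E|F|² is a double integral of the characteristic function at differences of
  -- points of the box.
  set F : Ω → ℂ := fun ω => ∫ u, e u ω ∂ν with hF
  have hFsq : ∀ ω, ((‖F ω‖ ^ 2 : ℝ) : ℂ) = ∫ q, e (q.1 - q.2) ω ∂(ν.prod ν) := by
    intro ω
    rw [← Complex.normSq_eq_norm_sq, ← Complex.mul_conj, hF, ← integral_conj, ← integral_prod_mul]
    refine integral_congr_ae (ae_of_all _ fun q => ?_)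
    simp only [he]
    rw [← Complex.exp_conj, ← Complex.exp_add]
    congr 1
    simp only [map_mul, Complex.conj_ofReal, Complex.conj_I, Pi.sub_apply, sub_mul,
      Finset.sum_sub_distrib]
    push_cast
    ring
  have hlow : ∀ ω, (∀ i, |Y ω i| ≤ 1) → V ^ 2 / 4 ≤ ‖F ω‖ ^ 2 := by
    intro ω hω
    have hint : Integrable (fun u => e u ω) ν :=
      (integrable_const (1 : ℝ)).mono'
        (hemeas.comp (measurable_id.prodMk measurable_const)).aestronglyMeasurable
        (ae_of_all _ fun u => (henorm u ω).le)
    have h1 : V / 2 ≤ (F ω).re := by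
      have h2 : (F ω).re = ∫ u, (e u ω).re ∂ν := (integral_re hint).symm
      rw [h2, ← hνV, div_eq_mul_one_div]
      have h3 : ν.real Set.univ * (1 / 2) = ∫ _u, (1 / 2 : ℝ) ∂ν := by simp
      rw [h3]
      refine integral_mono_ae (integrable_const _) hint.re ?_
      filter_upwards [hνmem] with u hu
      change (1 / 2 : ℝ) ≤ (e u ω).re
      simp only [he, Complex.exp_ofReal_mul_I_re]
      have h4 : |∑ i, u i * Y ω i| ≤ 1 := by
        refine (Finset.abs_sum_le_sum_abs _ _).trans (le_trans ?_ hηd)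
        calc ∑ i, |u i * Y ω i| ≤ ∑ _i : Fin d, η := by
              refine Finset.sum_le_sum fun i _ => ?_
              rw [abs_mul]
              calc |u i| * |Y ω i| ≤ η * 1 :=
                    mul_le_mul (hu i) (hω i) (abs_nonneg _) hη.le
                _ = η := mul_one _
          _ = d * η := by simp
      have h5 := Real.one_sub_sq_div_two_le_cos (x := ∑ i, u i * Y ω i)
      have h6 : (∑ i, u i * Y ω i) ^ 2 ≤ 1 := by
        rw [← sq_abs]; exact pow_le_one₀ (abs_nonneg _) h4
      linarith
    have h7 := (h1.trans (le_abs_self _)).trans (Complex.abs_re_le_norm (F ω))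
    calc V ^ 2 / 4 = (V / 2) ^ 2 := by ring
      _ ≤ _ := pow_le_pow_left₀ (by positivity) h7 2
  have hFmeas : Measurable F := by
    have : StronglyMeasurable fun ω => ∫ u, e u ω ∂ν :=
      (hemeas.comp measurable_swap).stronglyMeasurable.integral_prod_right'
        (f := fun q : Ω × (Fin d → ℝ) => e q.2 q.1)
    exact this.measurable
  have hFle : ∀ ω, ‖F ω‖ ≤ V := by
    intro ω
    refine (norm_integral_le_integral_norm _).trans ?_
    simp [henorm, hνV]
  have hFint : Integrable (fun ω => ‖F ω‖ ^ 2) P :=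
    (integrable_const (V ^ 2)).mono' (hFmeas.norm.pow_const 2).aestronglyMeasurable
      (ae_of_all _ fun ω => by
        rw [Real.norm_of_nonneg (by positivity)]
        exact pow_le_pow_left₀ (norm_nonneg _) (hFle ω) 2)
  have hset : MeasurableSet {ω | ∀ i, |Y ω i| ≤ 1} := by
    rw [Set.ofPred_forall]
    exact MeasurableSet.iInter fun i => measurableSet_le (hYi i).abs measurable_const
  have hmarkov : V ^ 2 / 4 * P.real {ω | ∀ i, |Y ω i| ≤ 1} ≤ ∫ ω, ‖F ω‖ ^ 2 ∂P := by
    calc V ^ 2 / 4 * P.real {ω | ∀ i, |Y ω i| ≤ 1}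
        = ∫ ω, {ω | ∀ i, |Y ω i| ≤ 1}.indicator (fun _ => V ^ 2 / 4) ω ∂P := by
          rw [integral_indicator_const _ hset, smul_eq_mul, mul_comm]
      _ ≤ _ := by
          refine integral_mono ((integrable_const _).indicator hset) hFint fun ω => ?_
          by_cases h : ω ∈ {ω | ∀ i, |Y ω i| ≤ 1}
          · simpa only [Set.indicator_of_mem h] using hlow ω h
          · simpa only [Set.indicator_of_notMem h] using sq_nonneg _
  set g : (Fin d → ℝ) → ℝ := fun t => ∏ i, Real.exp (-β * t i ^ 2) with hg
  have hgcont : Continuous g := by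
    simp only [hg]
    fun_prop
  have hg1 : ∀ t, ‖g t‖ ≤ 1 := fun t => by
    rw [Real.norm_of_nonneg (Finset.prod_nonneg fun i _ => (Real.exp_pos _).le)]
    refine Finset.prod_le_one (fun i _ => (Real.exp_pos _).le) fun i _ => ?_
    rw [Real.exp_le_one_iff]
    nlinarith [sq_nonneg (t i)]
  have hgint : Integrable (fun q : (Fin d → ℝ) × (Fin d → ℝ) => g (q.1 - q.2)) (ν.prod ν) :=
    (integrable_const (1 : ℝ)).mono'
      (hgcont.comp (continuous_fst.sub continuous_snd)).measurable.aestronglyMeasurable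
      (ae_of_all _ fun q => hg1 _)
  have hupper : ∫ ω, ‖F ω‖ ^ 2 ∂P ≤ V * √(Real.pi / β) ^ d := by
    have hint : Integrable (fun q : Ω × ((Fin d → ℝ) × (Fin d → ℝ)) => e (q.2.1 - q.2.2) q.1)
        (P.prod (ν.prod ν)) :=
      (integrable_const (1 : ℝ)).mono'
        (hemeas.comp ((measurable_snd.fst.sub measurable_snd.snd).prodMk
          measurable_fst)).aestronglyMeasurable
        (ae_of_all _ fun q => (henorm _ _).le)
    have h1 : ((∫ ω, ‖F ω‖ ^ 2 ∂P : ℝ) : ℂ)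
        = ∫ q, ∫ ω, e (q.1 - q.2) ω ∂P ∂(ν.prod ν) := by
      rw [← integral_complex_ofReal]
      simp only [hFsq]
      exact integral_integral_swap hint
    calc ∫ ω, ‖F ω‖ ^ 2 ∂P = ‖((∫ ω, ‖F ω‖ ^ 2 ∂P : ℝ) : ℂ)‖ := by
          rw [Complex.norm_real, Real.norm_of_nonneg (integral_nonneg fun ω => sq_nonneg _)]
      _ ≤ ∫ q, g (q.1 - q.2) ∂(ν.prod ν) := by
          rw [h1]
          refine norm_integral_le_of_norm_le hgint ?_
          have hm1 : ∀ᵐ q ∂(ν.prod ν), ∀ i, |q.1 i| ≤ η :=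
            Measure.quasiMeasurePreserving_fst.ae hνmem
          have hm2 : ∀ᵐ q ∂(ν.prod ν), ∀ i, |q.2 i| ≤ η :=
            Measure.quasiMeasurePreserving_snd.ae hνmem
          filter_upwards [hm1, hm2] with q hq1 hq2
          refine hchar _ fun i => ?_
          rw [Pi.sub_apply]
          linarith [abs_sub (q.1 i) (q.2 i), hq1 i, hq2 i]
      _ = ∫ v, ∫ u, g (u - v) ∂ν ∂ν := integral_prod_symm _ hgint
      _ ≤ ∫ _v, √(Real.pi / β) ^ d ∂ν := by
          refine integral_mono hgint.integral_prod_right (integrable_const _) fun v => ?_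
          simp only [hg, hν, Pi.sub_apply]
          rw [integral_fintype_prod_eq_prod (fun i x => Real.exp (-β * (x - v i) ^ 2))]
          refine (Finset.prod_le_prod (fun i _ => integral_nonneg fun x => (Real.exp_pos _).le)
            fun i _ => integral_exp_neg_mul_sq_sub_le hβ (v i)).trans ?_
          simp
      _ = V * √(Real.pi / β) ^ d := by simp [hνV]
  have h8 := hmarkov.trans hupper
  rw [div_mul_eq_mul_div, le_div_iff₀ hVpos]
  have h9 : V * (P.real {ω | ∀ i, |Y ω i| ≤ 1} * V) ≤ V * (4 * √(Real.pi / β) ^ d) := by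
    linarith [h8]
  exact le_of_mul_le_mul_left h9 hVpos

theorem IsIID.charFun_sum {Ω : Type*} [MeasurableSpace Ω] {P : Measure Ω} {μ : Measure ℝ}
    {ξ : ℤ → Ω → ℝ} (hξ : IsIID P μ ξ) (J : Finset ℤ) (v : ℤ → ℝ) :
    charFun (P.map fun ω => ∑ j ∈ J, v j * ξ j ω) 1 = ∏ j ∈ J, charFun μ (v j) := by
  obtain ⟨hmeas, hlaw, hind⟩ := hξ
  have h1 : iIndepFun (fun j ω => v j * ξ j ω) P :=
    hind.comp (fun j x => v j * x) fun j => measurable_const_mul _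
  rw [iIndepFun.charFun_map_fun_finsetSum_eq_prod (X := fun j ω => v j * ξ j ω)
    (fun j _ => ((hmeas j).const_mul _).aemeasurable) (h1.restrict J), Finset.prod_apply]
  refine Finset.prod_congr rfl fun j _ => ?_
  rw [charFun_map_mul_comp (hmeas j).aemeasurable, hlaw j, mul_one]

/-- Small ball estimate for `d` linear forms in i.i.d. variables, uniform over an independent
random shift. -/
theorem exists_smallBall_linearForms (μ : Measure ℝ) [IsProbabilityMeasure μ]
    (hL2 : MemLp id 2 μ) (hmean : ∫ x, x ∂μ = 0) (hvar : 0 < variance id μ) (d : ℕ) :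
    ∃ C : ℝ, 0 < C ∧ ∀ (Ω : Type*) [MeasurableSpace Ω] (P : Measure Ω) [IsProbabilityMeasure P]
      (ξ : ℤ → Ω → ℝ) (ξs : Ω → ℝ), IsIID P μ ξ → Measurable ξs → ∀ J : Finset ℤ,
      (∀ v : ℤ → ℝ, IndepFun (fun ω => ∑ j ∈ J, v j * ξ j ω) ξs P) →
      ∀ (u : Fin d → ℤ → ℝ) (b : Fin d → ℝ) (κ : ℝ), (∀ i j, |u i j| ≤ 2) → 0 < κ →
      (∀ θ : Fin d → ℝ, κ * ∑ i, θ i ^ 2 ≤ ∑ j ∈ J, (∑ i, θ i * u i j) ^ 2) →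
      P.real {ω | ∀ i, |∑ j ∈ J, u i j * ξ j ω + b i * ξs ω| ≤ 1} ≤ C * (√κ)⁻¹ ^ d := by
  obtain ⟨c, r, hc, hr, hdecay⟩ := exists_norm_charFun_le μ hL2 hmean hvar
  -- For |t_i| ≤ 2η and |u_ij| ≤ 2 the combined coefficient is at most 4dη ≤ r, inside the range of
  -- Gaussian decay. The denominator d + 1 also covers d = 0.
  set η : ℝ := min 1 (r / 4) / (d + 1) with hη
  have hη0 : 0 < η := by positivity
  have hηd : (d + 1) * η = min 1 (r / 4) := by rw [hη]; field_simp
  have hd0 : (0 : ℝ) ≤ d := Nat.cast_nonneg d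
  have hη1 : d * η ≤ 1 := by linarith [min_le_left 1 (r / 4)]
  have hη2 : d * η ≤ r / 4 := by linarith [min_le_right 1 (r / 4)]
  refine ⟨4 / (2 * η) ^ d * √(Real.pi / c) ^ d, by positivity, ?_⟩
  intro Ω _ P _ ξ ξs hξ hξs J hind u b κ hu hκ hgram
  have hlin : ∀ v : ℤ → ℝ, Measurable fun ω => ∑ j ∈ J, v j * ξ j ω := fun v =>
    Finset.measurable_sum _ fun j _ => (hξ.1 j).const_mul _
  set Y : Ω → Fin d → ℝ := fun ω i => ∑ j ∈ J, u i j * ξ j ω + b i * ξs ω with hYdef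
  have hY : Measurable Y := measurable_pi_lambda _ fun i => (hlin _).add (hξs.const_mul _)
  refine (prob_le_of_charFun_le P Y hY (β := c * κ) hη0 hη1 (by positivity) ?_).trans_eq ?_
  · intro t ht
    set v : ℤ → ℝ := fun j => ∑ i, t i * u i j with hv
    set W : Ω → ℝ := fun ω => (∑ i, t i * b i) * ξs ω with hW
    have hWm : Measurable W := hξs.const_mul _
    have hsum : ∀ ω, ∑ i, t i * Y ω i = ∑ j ∈ J, v j * ξ j ω + W ω := by
      intro ω
      simp only [hYdef, hv, hW, mul_add, Finset.sum_add_distrib, Finset.sum_mul, Finset.mul_sum]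
      rw [Finset.sum_comm]
      simp only [mul_assoc]
    have hchar : ∫ ω, Complex.exp (((∑ i, t i * Y ω i : ℝ) : ℂ) * Complex.I) ∂P
        = charFun (P.map fun ω => ∑ j ∈ J, v j * ξ j ω) 1 * charFun (P.map W) 1 := by
      have h1 : IndepFun (fun ω => ∑ j ∈ J, v j * ξ j ω) W P :=
        (hind v).comp measurable_id (measurable_const_mul _)
      rw [← Pi.mul_apply, ← h1.charFun_map_add_eq_mul (hlin v).aemeasurable hWm.aemeasurable,
        charFun_apply_real, integral_map ((hlin v).add hWm).aemeasurable (by fun_prop)]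
      simp only [hsum, Pi.add_apply, Complex.ofReal_one, one_mul]
    have : IsProbabilityMeasure (P.map W) := Measure.isProbabilityMeasure_map hWm.aemeasurable
    have hvr : ∀ j, |v j| ≤ r := by
      intro j
      calc |v j| ≤ ∑ i, |t i * u i j| := Finset.abs_sum_le_sum_abs _ _
        _ ≤ ∑ _i : Fin d, 2 * η * 2 := by
            refine Finset.sum_le_sum fun i _ => ?_
            rw [abs_mul]
            exact mul_le_mul (ht i) (hu i j) (abs_nonneg _) (by positivity)
        _ = 4 * (d * η) := by simp; ring
        _ ≤ r := by linarith
    -- The independent shift contributes a factor of modulus at most 1, so its law does not matter.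
    rw [hchar, hξ.charFun_sum, norm_mul, ← Real.exp_sum]
    calc _ ≤ ‖∏ j ∈ J, charFun μ (v j)‖ * 1 := by
          gcongr
          exact norm_charFun_le_one _
      _ ≤ ∏ j ∈ J, Real.exp (-c * v j ^ 2) := by
          rw [mul_one, norm_prod]
          exact Finset.prod_le_prod (fun _ _ => norm_nonneg _) fun j _ => hdecay _ (hvr j)
      _ = Real.exp (-c * ∑ j ∈ J, v j ^ 2) := by rw [← Real.exp_sum, Finset.mul_sum]
      _ ≤ Real.exp (∑ i, -(c * κ) * t i ^ 2) := by
          rw [Real.exp_le_exp, ← Finset.mul_sum]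
          have := mul_le_mul_of_nonneg_left (hgram t) hc.le
          linarith
  · rw [← div_div, Real.sqrt_div (by positivity), div_pow, inv_pow]
    ring

/-! ### Exponential tails of linear forms. -/

/-- The moment generating function of a centred subexponential law is subgaussian near zero. -/
theorem exists_mgf_le (μ : Measure ℝ) [IsProbabilityMeasure μ] (hmean : ∫ x, x ∂μ = 0)
    (hmgf : HasMgfNearZero μ) :
    ∃ c r : ℝ, 0 < c ∧ 0 < r ∧ ∀ t : ℝ, |t| ≤ r →
      Integrable (fun x => Real.exp (t * x)) μ ∧ mgf id μ t ≤ Real.exp (c * t ^ 2) := by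
  obtain ⟨δ, hδ, hint⟩ := hmgf
  have h0 : (0 : ℝ) ∈ interior (integrableExpSet id μ) := by
    rw [mem_interior]
    exact ⟨Set.Ioo (-δ) δ, fun t ht => hint t ht, isOpen_Ioo, by simpa using hδ⟩
  obtain ⟨p, hp⟩ := analyticAt_mgf h0
  -- The generating function is analytic at 0 with constant term 1 and linear term the mean, which
  -- is 0; hence it is 1 + O(t²) ≤ exp(c t²).
  have hO := hp.isBigO_sub_partialSum_pow 2
  have hsum : ∀ y, p.partialSum 2 y = 1 := by
    intro y
    have h1 : p.coeff 0 = 1 := (hp.coeff_zero _).trans (by simp)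
    have h2 : p.coeff 1 = 0 := by
      have := hp.hasDerivAt.deriv
      rw [deriv_mgf_zero h0] at this
      exact this.symm.trans (by simpa using hmean)
    simp [FormalMultilinearSeries.partialSum, Finset.sum_range_succ, h1, h2]
  simp only [hsum, zero_add] at hO
  obtain ⟨c, hc, hbound⟩ := hO.exists_pos
  obtain ⟨r, hr, hball⟩ := Metric.eventually_nhds_iff.1 hbound.bound
  refine ⟨c, min (r / 2) (δ / 2), hc, by positivity, fun t ht => ⟨?_, ?_⟩⟩
  · have : |t| ≤ δ / 2 := ht.trans (min_le_right _ _)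
    exact hint t (abs_lt.1 (by linarith))
  · have h1 : |t| ≤ r / 2 := ht.trans (min_le_left _ _)
    have h2 := hball (y := t) (by rw [dist_zero_right, Real.norm_eq_abs]; linarith)
    simp only [norm_pow, Real.norm_eq_abs, sq_abs] at h2
    linarith [(le_abs_self _).trans h2, Real.add_one_le_exp (c * t ^ 2)]

/-- Chernoff bound at the scale `√(n log n)` for linear forms in i.i.d. subexponential
variables. -/
theorem exists_tail_linearForm (μ : Measure ℝ) [IsProbabilityMeasure μ] (hmean : ∫ x, x ∂μ = 0)
    (hmgf : HasMgfNearZero μ) :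
    ∃ K : ℝ, 0 < K ∧ ∀ᶠ n : ℕ in atTop, ∀ (Ω : Type*) [MeasurableSpace Ω] (P : Measure Ω)
      [IsProbabilityMeasure P] (ξ : ℤ → Ω → ℝ), IsIID P μ ξ → ∀ (J : Finset ℤ) (u : ℤ → ℝ),
      J.card ≤ 2 * n → (∀ j, |u j| ≤ 2) →
      P.real {ω | K * √(n * Real.log n) ≤ |∑ j ∈ J, u j * ξ j ω|} ≤ 2 / (n : ℝ) ^ 3 := by
  obtain ⟨c, r, hc, hr, hsub⟩ := exists_mgf_le μ hmean hmgf
  -- With t = √(log n / n), at most 2n factors exp(4ct²) cost exp(8c log n). The remaining 3 leaves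
  -- n^{-3}, enough for a union over 2n + 1 frequencies.
  refine ⟨8 * c + 3, by positivity, ?_⟩
  have hlim : Tendsto (fun n : ℕ => Real.log n / n) atTop (𝓝 0) := by
    have := (Real.isLittleO_log_id_atTop.tendsto_div_nhds_zero).comp tendsto_natCast_atTop_atTop
    exact this
  filter_upwards [hlim.eventually_lt_const (show 0 < (r / 2) ^ 2 by positivity),
    eventually_ge_atTop 1] with n hn hn1
  intro Ω _ P _ ξ hξ J u hJ hu
  have hn0 : (0 : ℝ) < n := by exact_mod_cast hn1
  have hlog : 0 ≤ Real.log n := Real.log_nonneg (by exact_mod_cast hn1)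
  set t : ℝ := √(Real.log n / n) with ht
  have ht0 : 0 ≤ t := Real.sqrt_nonneg _
  have htr : t ≤ r / 2 := by
    rw [ht, Real.sqrt_le_left (by positivity)]
    exact hn.le
  have ht2 : t ^ 2 = Real.log n / n := Real.sq_sqrt (by positivity)
  have hta : t * √(n * Real.log n) = Real.log n := by
    rw [ht, ← Real.sqrt_mul (by positivity)]
    have : Real.log n / n * (n * Real.log n) = Real.log n ^ 2 := by field_simp
    rw [this, Real.sqrt_sq hlog]
  have hside : ∀ w : ℤ → ℝ, (∀ j, |w j| ≤ 2) →
      P.real {ω | (8 * c + 3) * √(n * Real.log n) ≤ ∑ j ∈ J, w j * ξ j ω} ≤ 1 / (n : ℝ) ^ 3 := by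
    intro w hw
    have htw : ∀ j, |t * w j| ≤ r := fun j => by
      rw [abs_mul, abs_of_nonneg ht0]
      have := mul_le_mul htr (hw j) (abs_nonneg _) (by positivity)
      linarith
    have hind : iIndepFun (fun j ω => w j * ξ j ω) P :=
      hξ.2.2.comp (fun j x => w j * x) fun j => measurable_const_mul _
    have hm : ∀ j, Measurable fun ω => w j * ξ j ω := fun j => (hξ.1 j).const_mul _
    have hi : ∀ j ∈ J, Integrable (fun ω => Real.exp (t * (w j * ξ j ω))) P := fun j _ => by
      have h1 := (hsub _ (htw j)).1
      rw [← hξ.2.1 j] at h1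
      have h2 := h1.comp_measurable (hξ.1 j)
      simpa only [Function.comp_def, mul_assoc] using h2
    have hmgfj : ∀ j, mgf (fun ω => w j * ξ j ω) P t = mgf id μ (t * w j) := fun j => by
      rw [mgf_const_mul, ← hξ.2.1 j, mgf_id_map (hξ.1 j).aemeasurable, mul_comm]
    have h1 := measure_ge_le_exp_mul_mgf (μ := P) (X := ∑ j ∈ J, fun ω => w j * ξ j ω)
      ((8 * c + 3) * √(n * Real.log n)) ht0 (hind.integrable_exp_mul_sum hm hi)
    rw [hind.mgf_sum hm] at h1
    simp only [hmgfj, Finset.sum_apply] at h1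
    refine h1.trans ?_
    have h2 : ∏ j ∈ J, mgf id μ (t * w j) ≤ Real.exp (8 * c * Real.log n) := by
      calc ∏ j ∈ J, mgf id μ (t * w j) ≤ ∏ _j ∈ J, Real.exp (4 * c * t ^ 2) := by
            refine Finset.prod_le_prod (fun j _ => mgf_nonneg) fun j _ => ?_
            refine (hsub _ (htw j)).2.trans ?_
            rw [Real.exp_le_exp]
            have : w j ^ 2 ≤ 2 ^ 2 := by
              rw [← sq_abs]; exact pow_le_pow_left₀ (abs_nonneg _) (hw j) 2
            have := mul_le_mul_of_nonneg_left this (show 0 ≤ c * t ^ 2 by positivity)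
            linarith
        _ = Real.exp (J.card * (4 * c * t ^ 2)) := by
            rw [Finset.prod_const, ← Real.exp_nat_mul]
        _ ≤ Real.exp (8 * c * Real.log n) := by
            rw [Real.exp_le_exp]
            have h3 : (J.card : ℝ) ≤ 2 * n := by exact_mod_cast hJ
            calc (J.card : ℝ) * (4 * c * t ^ 2) ≤ 2 * n * (4 * c * t ^ 2) := by gcongr
              _ = 8 * c * Real.log n := by rw [ht2]; field_simp; ring
    calc _ ≤ Real.exp (-t * ((8 * c + 3) * √(n * Real.log n))) * Real.exp (8 * c * Real.log n) := by
          gcongr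
      _ = Real.exp (-(3 * Real.log n)) := by
          rw [← Real.exp_add]
          congr 1
          linear_combination (-(8 * c + 3)) * hta
      _ = 1 / (n : ℝ) ^ 3 := by
          rw [Real.exp_neg, one_div]
          congr 1
          rw [mul_comm, Real.exp_mul, Real.exp_log hn0]
          norm_cast
  have h1 := hside u hu
  have h2 := hside (fun j => -u j) (fun j => by rw [abs_neg]; exact hu j)
  calc _ ≤ P.real ({ω | (8 * c + 3) * √(n * Real.log n) ≤ ∑ j ∈ J, u j * ξ j ω} ∪
        {ω | (8 * c + 3) * √(n * Real.log n) ≤ ∑ j ∈ J, -u j * ξ j ω}) := by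
        refine measureReal_mono fun ω hω => ?_
        have hω' : (8 * c + 3) * √(n * Real.log n) ≤ |∑ j ∈ J, u j * ξ j ω| := hω
        rcases le_abs.1 hω' with h | h
        · exact Or.inl h
        · refine Or.inr ?_
          simpa only [Set.mem_ofPred_eq, neg_mul, Finset.sum_neg_distrib] using h
    _ ≤ _ := measureReal_union_le _ _
    _ ≤ 1 / (n : ℝ) ^ 3 + 1 / (n : ℝ) ^ 3 := add_le_add h1 h2
    _ = 2 / (n : ℝ) ^ 3 := by ring

/-! ### Near-orthogonality of cosine vectors. -/

/-- This is the real part of a complete character sum on `ZMod (n + n)`, indexed by representatives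
in (-n, n]. -/
theorem sum_Ioc_cos {n : ℕ} (hn : 0 < n) (j : ℤ) :
    ∑ d ∈ Finset.Ioc (-(n : ℤ)) n, Real.cos (Real.pi * d * j / n)
      = if 2 * (n : ℤ) ∣ j then 2 * (n : ℝ) else 0 := by
  have : NeZero (n + n) := ⟨by omega⟩
  have hmem : ∀ d ∈ Finset.Ioc (-(n : ℤ)) n, ((d : ZMod (n + n))).valMinAbs = d := by
    intro d hd
    rw [Finset.mem_Ioc] at hd
    rw [ZMod.valMinAbs_spec]
    refine ⟨rfl, ?_, ?_⟩ <;> push_cast <;> linarith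
  have hchar : ∀ d : ℤ, (ZMod.stdAddChar ((j : ZMod (n + n)) * (d : ZMod (n + n))) : ℂ).re
      = Real.cos (Real.pi * d * j / n) := by
    intro d
    rw [← Int.cast_mul, ZMod.stdAddChar_coe]
    have h2 : 2 * Real.pi * Complex.I * ((j * d : ℤ) : ℂ) / ((n + n : ℕ) : ℂ)
        = ((Real.pi * d * j / n : ℝ) : ℂ) * Complex.I := by
      have : (n : ℂ) ≠ 0 := by exact_mod_cast hn.ne'
      push_cast
      field_simp
      ring
    rw [h2, Complex.exp_ofReal_mul_I_re]
  have h1 : ∑ w : ZMod (n + n), (ZMod.stdAddChar ((j : ZMod (n + n)) * w) : ℂ).re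
      = ∑ d ∈ Finset.Ioc (-(n : ℤ)) n, Real.cos (Real.pi * d * j / n) := by
    refine Finset.sum_nbij' ZMod.valMinAbs (fun d : ℤ => (d : ZMod (n + n))) ?_ (by simp)
      (by simp) hmem ?_
    · intro w _
      have := ZMod.valMinAbs_mem_Ioc w
      rw [Set.mem_Ioc] at this
      rw [Finset.mem_Ioc]
      push_cast at this
      omega
    · intro w _
      rw [← hchar, ZMod.coe_valMinAbs]
  have h3 : ((j : ZMod (n + n)) = 0) ↔ 2 * (n : ℤ) ∣ j := by
    rw [ZMod.intCast_zmod_eq_zero_iff_dvd]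
    push_cast
    rw [two_mul]
  rw [← h1, ← Complex.re_sum, sum_stdAddChar_mul]
  simp only [h3]
  split_ifs
  · push_cast; simp; ring
  · simp

theorem sum_Ioc_cos_mul_cos {n : ℕ} (hn : 0 < n) (k l : ℤ) :
    ∑ d ∈ Finset.Ioc (-(n : ℤ)) n,
        Real.cos (Real.pi * d * k / n) * Real.cos (Real.pi * d * l / n)
      = ((if 2 * (n : ℤ) ∣ k - l then (n : ℝ) else 0)
          + if 2 * (n : ℤ) ∣ k + l then (n : ℝ) else 0) := by
  have h1 := sum_Ioc_cos hn (k - l)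
  have h2 := sum_Ioc_cos hn (k + l)
  have h3 : ∀ d : ℤ, Real.cos (Real.pi * d * k / n) * Real.cos (Real.pi * d * l / n)
      = (Real.cos (Real.pi * d * (k - l : ℤ) / n)
        + Real.cos (Real.pi * d * (k + l : ℤ) / n)) / 2 := by
    intro d
    have h4 : Real.pi * d * (k - l : ℤ) / n = Real.pi * d * k / n - Real.pi * d * l / n := by
      push_cast; ring
    have h5 : Real.pi * d * (k + l : ℤ) / n = Real.pi * d * k / n + Real.pi * d * l / n := by
      push_cast; ring
    rw [h4, h5, Real.cos_sub, Real.cos_add]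
    ring
  simp only [h3]
  rw [← Finset.sum_div, Finset.sum_add_distrib, h1, h2]
  split_ifs <;> ring

/-- Lower bound for the Gram form of distinct cosine vectors of length `2n - 1`. -/
theorem le_sum_Ioo_sq_sum_cos {n d : ℕ} (hn : 0 < n) (k : Fin d → ℤ)
    (hk : Function.Injective k) (hk0 : ∀ i, 0 ≤ k i) (hkn : ∀ i, k i ≤ n) (θ : Fin d → ℝ) :
    ((n : ℝ) - d) * ∑ i, θ i ^ 2 ≤ ∑ j ∈ Finset.Ioo (-(n : ℤ)) n,
      (∑ i, θ i * Real.cos (Real.pi * j * k i / n)) ^ 2 := by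
  have hIoc : Finset.Ioc (-(n : ℤ)) n = insert (n : ℤ) (Finset.Ioo (-(n : ℤ)) n) := by
    ext d
    simp only [Finset.mem_Ioc, Finset.mem_insert, Finset.mem_Ioo]
    omega
  -- Orthogonality needs the full period, but position n belongs to s and not to the i.i.d. entries.
  -- Dropping it costs at most d times Σ θ_i², by Cauchy–Schwarz.
  have hlast : (∑ i, θ i * Real.cos (Real.pi * (n : ℤ) * k i / n)) ^ 2 ≤ d * ∑ i, θ i ^ 2 := by
    have h := sq_sum_le_card_mul_sum_sq (s := (Finset.univ : Finset (Fin d)))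
      (f := fun i => θ i * Real.cos (Real.pi * (n : ℤ) * k i / n))
    rw [Finset.card_univ, Fintype.card_fin] at h
    refine h.trans (mul_le_mul_of_nonneg_left (Finset.sum_le_sum fun i _ => ?_) (by positivity))
    rw [mul_pow]
    exact mul_le_of_le_one_right (sq_nonneg _) (Real.cos_sq_le_one _)
  have hfull : (n : ℝ) * ∑ i, θ i ^ 2 ≤ ∑ j ∈ Finset.Ioc (-(n : ℤ)) n,
      (∑ i, θ i * Real.cos (Real.pi * j * k i / n)) ^ 2 := by
    have h1 : ∑ j ∈ Finset.Ioc (-(n : ℤ)) n, (∑ i, θ i * Real.cos (Real.pi * j * k i / n)) ^ 2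
        = ∑ i, ∑ i', θ i * θ i' * ∑ j ∈ Finset.Ioc (-(n : ℤ)) n,
          Real.cos (Real.pi * j * k i / n) * Real.cos (Real.pi * j * k i' / n) := by
      simp only [sq, Finset.sum_mul_sum]
      simp only [Finset.mul_sum]
      rw [Finset.sum_comm]
      refine Finset.sum_congr rfl fun i _ => ?_
      rw [Finset.sum_comm]
      exact Finset.sum_congr rfl fun i' _ => Finset.sum_congr rfl fun j _ => by ring
    -- For distinct frequencies in [0, n] the difference is nonzero of modulus at most n, and the
    -- sum lies strictly between 0 and 2n.
    have hoff : ∀ i i', i' ≠ i → ¬ 2 * (n : ℤ) ∣ k i - k i' ∧ ¬ 2 * (n : ℤ) ∣ k i + k i' := by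
      intro i i' hne
      have hki : k i' ≠ k i := fun h => hne (hk h)
      have := hk0 i; have := hk0 i'; have := hkn i; have := hkn i'
      have hn' : (0 : ℤ) < n := by exact_mod_cast hn
      constructor
      · rintro ⟨q, hq⟩
        rcases lt_trichotomy q 0 with h | h | h
        · nlinarith
        · rw [h] at hq; omega
        · nlinarith
      · rintro ⟨q, hq⟩
        rcases lt_trichotomy q 1 with h | h | h
        · have : q ≤ 0 := by omega
          have : k i + k i' ≤ 0 := by nlinarith
          omega
        · rw [h] at hq; omega
        · have : 2 * (n : ℤ) < 2 * n * q := by nlinarith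
          omega
    rw [h1, Finset.mul_sum]
    refine Finset.sum_le_sum fun i _ => ?_
    rw [Finset.sum_eq_single i (fun i' _ hne => by
      rw [sum_Ioc_cos_mul_cos hn, if_neg (hoff i i' hne).1, if_neg (hoff i i' hne).2]
      ring) (by simp), sum_Ioc_cos_mul_cos hn, sub_self, if_pos (dvd_zero _)]
    have : (0 : ℝ) ≤ if 2 * (n : ℤ) ∣ k i + k i then (n : ℝ) else 0 := by positivity
    nlinarith [mul_self_nonneg (θ i)]
  rw [hIoc, Finset.sum_insert (by simp)] at hfull
  linarith

/-! ### Folding the symmetric case. -/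

/-- The coefficient map which folds `∑ x |d| f d` into a sum over nonnegative indices. -/
def symmetricFold : (ℤ → ℝ) →ₗ[ℝ] (ℤ → ℝ) where
  toFun f j := if j = 0 then f 0 else f j + f (-j)
  map_add' f g := by
    ext j
    by_cases h : j = 0 <;> simp [h]
    ring
  map_smul' c f := by
    ext j
    by_cases h : j = 0 <;> simp [h]
    ring

theorem symmetricFold_apply (f : ℤ → ℝ) (j : ℤ) :
    symmetricFold f j = if j = 0 then f 0 else f j + f (-j) := rfl

theorem sum_Ioo_abs_mul (n : ℕ) (x f : ℤ → ℝ) :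
    ∑ d ∈ Finset.Ioo (-(n : ℤ)) n, x |d| * f d
      = ∑ j ∈ Finset.Ico (0 : ℤ) n, symmetricFold f j * x j := by
  rcases Nat.eq_zero_or_pos n with rfl | hn
  · simp
  have hn' : (0 : ℤ) < n := by exact_mod_cast hn
  have h1 : Finset.Ioo (-(n : ℤ)) n
      = insert 0 (Finset.Ioo 0 (n : ℤ)) ∪ (Finset.Ioo 0 (n : ℤ)).map (Equiv.neg ℤ).toEmbedding := by
    ext d
    simp only [Finset.mem_Ioo, Finset.mem_union, Finset.mem_insert, Finset.mem_map,
      Equiv.coe_toEmbedding, Equiv.neg_apply]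
    constructor
    · intro h
      rcases lt_trichotomy d 0 with h0 | h0 | h0
      · exact Or.inr ⟨-d, by omega, by omega⟩
      · exact Or.inl (Or.inl h0)
      · exact Or.inl (Or.inr ⟨h0, h.2⟩)
    · rintro ((h | h) | ⟨e, h, he⟩) <;> omega
  have hdisj : Disjoint (insert 0 (Finset.Ioo 0 (n : ℤ)))
      ((Finset.Ioo 0 (n : ℤ)).map (Equiv.neg ℤ).toEmbedding) := by
    rw [Finset.disjoint_left]
    intro d hd
    simp only [Finset.mem_Ioo, Finset.mem_insert, Finset.mem_map,
      Equiv.coe_toEmbedding, Equiv.neg_apply] at hd ⊢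
    rintro ⟨e, h, he⟩
    omega
  have h2 : Finset.Ico (0 : ℤ) n = insert 0 (Finset.Ioo 0 (n : ℤ)) := by
    ext d
    simp only [Finset.mem_Ioo, Finset.mem_insert, Finset.mem_Ico]
    omega
  rw [h1, Finset.sum_union hdisj, h2, Finset.sum_insert (by simp), Finset.sum_insert (by simp),
    Finset.sum_map, add_assoc, ← Finset.sum_add_distrib]
  congr 1
  · simp [symmetricFold_apply, mul_comm]
  · refine Finset.sum_congr rfl fun j hj => ?_
    have hj0 := (Finset.mem_Ioo.1 hj).1
    simp only [Equiv.coe_toEmbedding, Equiv.neg_apply, abs_neg, abs_of_pos hj0,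
      symmetricFold_apply, if_neg hj0.ne']
    ring

/-- For even f the folded coefficient at j > 0 is 2f(j), whose square exceeds the two squares f(j)²
+ f(-j)² that it replaces. -/
theorem sum_Ioo_sq_le_sum_symmetricFold_sq (n : ℕ) (f : ℤ → ℝ) (hf : ∀ d, f (-d) = f d) :
    ∑ d ∈ Finset.Ioo (-(n : ℤ)) n, f d ^ 2
      ≤ ∑ j ∈ Finset.Ico (0 : ℤ) n, symmetricFold f j ^ 2 := by
  have h := sum_Ioo_abs_mul n (fun _ => 1) (fun d => f d ^ 2)
  simp only [one_mul, mul_one] at h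
  rw [h]
  refine Finset.sum_le_sum fun j _ => ?_
  simp only [symmetricFold_apply, hf]
  split_ifs
  · exact le_rfl
  · nlinarith [sq_nonneg (f j)]

/-! ### Clusters of small eigenvalues. -/

/-- The real part of the eigenvalues of the circulant matrix `[T_n, B_n; B_n, T_n]`. -/
noncomputable def eigenvalueRe (n : ℕ) (a : ℤ → ℝ) (s : ℝ) (k : ℤ) : ℝ :=
  ∑ d ∈ Finset.Ioo (-(n : ℤ)) n, a d * Real.cos (Real.pi * d * k / n) + s * Real.cos (Real.pi * k)

/-- Mirror frequencies share their real part, so independence can be exploited only within [0, n];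
this is why the ends of that range need a separate condition. -/
theorem eigenvalueRe_neg (n : ℕ) (a : ℤ → ℝ) (s : ℝ) (k : ℤ) :
    eigenvalueRe n a s (-k) = eigenvalueRe n a s k := by
  simp only [eigenvalueRe, Int.cast_neg, mul_neg, neg_div, Real.cos_neg]

theorem re_circulantEigenvalue_intCast {n : ℕ} [NeZero (n + n)] (a : ℤ → ℝ) (s : ℝ) (k : ℤ) :
    (circulantEigenvalue n a s (k : ZMod (n + n))).re = eigenvalueRe n a s k := by
  rw [circulantEigenvalue_intCast, eigenvalueRe, Complex.sub_re, Complex.re_ofReal_mul,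
    Complex.ofReal_re, Complex.I_re, mul_zero, sub_zero]

theorem abs_eigenvalueRe_le {n : ℕ} [NeZero (n + n)] (a : ℤ → ℝ) (s : ℝ) (k : ℤ) :
    |eigenvalueRe n a s k| ≤ ‖circulantEigenvalue n a s (k : ZMod (n + n))‖ := by
  rw [← re_circulantEigenvalue_intCast]
  exact Complex.abs_re_le_norm _

/-- No eigenvalue near the ends of the spectrum is small, and no three close eigenvalues are
simultaneously small. -/
structure NoCluster (n : ℕ) (a : ℤ → ℝ) (s : ℝ) : Prop where
  ends : ∀ k : ℤ, k ∈ Finset.Icc (0 : ℤ) (2 ^ 15) ∪ Finset.Icc ((n : ℤ) - 2 ^ 15) n →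
    1 < |eigenvalueRe n a s k|
  triple : ∀ k δ δ' : ℤ, 0 ≤ k → k ≤ n → 0 ≤ k + δ → k + δ ≤ n → 0 ≤ k + δ' → k + δ' ≤ n →
    |δ| ≤ 2 ^ 15 → |δ'| ≤ 2 ^ 15 → δ ≠ 0 → δ' ≠ 0 → δ ≠ δ' →
    |eigenvalueRe n a s k| ≤ 1 → |eigenvalueRe n a s (k + δ)| ≤ 1 →
    1 < |eigenvalueRe n a s (k + δ')|

theorem NoCluster.exists_unique_neighbour {n : ℕ} [NeZero (n + n)]
    {a : ℤ → ℝ} {s : ℝ} (h : NoCluster n a s) (k : ZMod (n + n))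
    (hk : ‖circulantEigenvalue n a s k‖ ≤ 1) :
    ∃ δ : ℤ, δ ≠ 0 ∧ |δ| ≤ 2 ^ 15 ∧
      ∀ l, ‖circulantEigenvalue n a s l‖ ≤ 1 → |(l - k).valMinAbs| ≤ 2 ^ 15 →
        l = k ∨ l = k + δ := by
  set K := k.valMinAbs with hK
  have hKk : ((K : ℤ) : ZMod (n + n)) = k := ZMod.coe_valMinAbs k
  have hKrange := ZMod.valMinAbs_mem_Ioc k
  rw [Set.mem_Ioc, ← hK] at hKrange
  push_cast at hKrange
  have habs : |eigenvalueRe n a s (|K|)| ≤ 1 := by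
    have h1 := abs_eigenvalueRe_le (n := n) a s K
    rw [hKk] at h1
    rcases abs_choice K with h2 | h2 <;> rw [h2]
    · exact h1.trans hk
    · rw [eigenvalueRe_neg]; exact h1.trans hk
  -- Away from the ends, a shift by at most 2^15 crosses neither 0 nor ±n, so the whole cluster can
  -- be mirrored into [0, n].
  have hmid : 2 ^ 15 < |K| ∧ |K| < n - 2 ^ 15 := by
    have hKn : |K| ≤ n := abs_le.2 ⟨by linarith, by linarith⟩
    have hK0 := abs_nonneg K
    constructor
    · by_contra hc
      exact absurd habs (not_le.2 (h.ends _ (Finset.mem_union_left _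
        (Finset.mem_Icc.2 ⟨hK0, not_lt.1 hc⟩))))
    · by_contra hc
      exact absurd habs (not_le.2 (h.ends _ (Finset.mem_union_right _
        (Finset.mem_Icc.2 ⟨not_lt.1 hc, hKn⟩))))
  have hnear : ∀ δ : ℤ, ‖circulantEigenvalue n a s (k + δ)‖ ≤ 1 →
      |eigenvalueRe n a s (K + δ)| ≤ 1 := by
    intro δ hδ
    refine (abs_eigenvalueRe_le (n := n) a s (K + δ)).trans ?_
    rwa [Int.cast_add, hKk]
  have htriple : ∀ δ δ' : ℤ, |δ| ≤ 2 ^ 15 → |δ'| ≤ 2 ^ 15 → δ ≠ 0 → δ' ≠ 0 →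
      ‖circulantEigenvalue n a s (k + δ)‖ ≤ 1 → ‖circulantEigenvalue n a s (k + δ')‖ ≤ 1 →
      δ = δ' := by
    intro δ δ' hδ hδ' h0 h0' hs hs'
    by_contra hne
    have hr := hnear δ hs
    have hr' := hnear δ' hs'
    rcases le_total 0 K with hpos | hneg
    · rw [abs_of_nonneg hpos] at hmid habs
      have h1 := abs_le.1 hδ
      have h2 := abs_le.1 hδ'
      exact absurd hr' (not_le.2 (h.triple K δ δ' hpos (by omega) (by omega) (by omega) (by omega)
        (by omega) hδ hδ' h0 h0' hne habs hr))
    · rw [abs_of_nonpos hneg] at hmid habs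
      have h1 := abs_le.1 hδ
      have h2 := abs_le.1 hδ'
      rw [← eigenvalueRe_neg, neg_add] at hr hr'
      exact absurd hr' (not_le.2 (h.triple (-K) (-δ) (-δ') (by omega) (by omega) (by omega)
        (by omega) (by omega) (by omega) (by rwa [abs_neg]) (by rwa [abs_neg]) (by omega)
        (by omega) (by omega) habs hr))
  have hdiff : ∀ l : ZMod (n + n), l = k + (((l - k).valMinAbs : ℤ) : ZMod (n + n)) := fun l => by
    rw [ZMod.coe_valMinAbs]; ring
  by_cases hex : ∃ l, ‖circulantEigenvalue n a s l‖ ≤ 1 ∧ |(l - k).valMinAbs| ≤ 2 ^ 15 ∧ l ≠ k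
  · obtain ⟨l, hl, hlk, hne⟩ := hex
    have hv0 : ∀ l : ZMod (n + n), l ≠ k → (l - k).valMinAbs ≠ 0 := fun l hl h0 =>
      hl (sub_eq_zero.1 ((ZMod.valMinAbs_eq_zero _).1 h0))
    refine ⟨(l - k).valMinAbs, hv0 l hne, hlk, fun l' hl' hlk' => ?_⟩
    by_cases hl'k : l' = k
    · exact Or.inl hl'k
    · refine Or.inr ?_
      rw [htriple _ _ hlk hlk' (hv0 l hne) (hv0 l' hl'k) (by rwa [← hdiff]) (by rwa [← hdiff]),
        ← hdiff]
  -- Without a second small eigenvalue nearby, any admissible δ serves.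
  · refine ⟨1, one_ne_zero, by norm_num, fun l hl hlk => ?_⟩
    by_contra hc
    exact hex ⟨l, hl, hlk, fun h => hc (Or.inl h)⟩

/-- Deterministic bound for the condition number in terms of the trigonometric sums. -/
theorem NoCluster.condNumber_le {n : ℕ} (hn : 2 ^ 16 ≤ n) {a : ℤ → ℝ} {s : ℝ}
    (h : NoCluster n a s) {R : ℝ} (hR : 1 ≤ R)
    (hcos : ∀ k ∈ Finset.Icc (-(n : ℤ)) n,
      |∑ d ∈ Finset.Ioo (-(n : ℤ)) n, a d * Real.cos (Real.pi * d * k / n)| ≤ R)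
    (hsin : ∀ k ∈ Finset.Icc (-(n : ℤ)) n,
      |∑ d ∈ Finset.Ioo (-(n : ℤ)) n, a d * Real.sin (Real.pi * d * k / n)| ≤ R) :
    condNumber (stackedToeplitz n a s) ≤ ENNReal.ofReal (2 ^ 26 * R) := by
  have : NeZero (n + n) := ⟨by omega⟩
  have hcard : Fintype.card (Fin n) ≤ Fintype.card (Fin n ⊕ Fin n) := by simp
  have hrep : ∀ k : ZMod (n + n), ∃ K ∈ Finset.Icc (-(n : ℤ)) n, ((K : ℤ) : ZMod (n + n)) = k := by
    intro k
    refine ⟨k.valMinAbs, ?_, ZMod.coe_valMinAbs k⟩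
    have := ZMod.valMinAbs_mem_Ioc k
    rw [Set.mem_Ioc] at this
    push_cast at this
    rw [Finset.mem_Icc]
    omega
  have hcospi : ∀ K : ℤ, |s * Real.cos (Real.pi * K)| = |s| := fun K => by
    rw [abs_mul, mul_comm Real.pi, Real.abs_cos_int_mul_pi, mul_one]
  have hup : ∀ k, ‖circulantEigenvalue n a s k‖ ≤ |s| + 2 * R := by
    intro k
    obtain ⟨K, hK, rfl⟩ := hrep k
    rw [circulantEigenvalue_intCast]
    refine (norm_sub_le _ _).trans ?_
    rw [norm_mul, Complex.norm_I, mul_one, Complex.norm_real, Complex.norm_real,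
      Real.norm_eq_abs, Real.norm_eq_abs]
    have h1 := abs_add_le (∑ d ∈ Finset.Ioo (-(n : ℤ)) n, a d * Real.cos (Real.pi * d * K / n))
      (s * Real.cos (Real.pi * K))
    rw [hcospi] at h1
    linarith [hcos K hK, hsin K hK]
  -- If |s| dominates, every eigenvalue lies between |s|/2 and |s| + 2R and no cluster argument is
  -- needed. Otherwise the upper bound is 6R, the lower bound is 2^{-23}, and 6 · 2^23 ≤ 2^26.
  rcases le_total (4 * R) |s| with hs | hs
  · have hlow : ∀ k, |s| / 2 ≤ ‖circulantEigenvalue n a s k‖ := by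
      intro k
      obtain ⟨K, hK, rfl⟩ := hrep k
      refine le_trans ?_ (abs_eigenvalueRe_le (n := n) a s K)
      have h1 := abs_sub_abs_le_abs_sub (s * Real.cos (Real.pi * K))
        (-∑ d ∈ Finset.Ioo (-(n : ℤ)) n, a d * Real.cos (Real.pi * d * K / n))
      rw [hcospi, abs_neg, sub_neg_eq_add, add_comm (s * Real.cos (Real.pi * K))] at h1
      rw [eigenvalueRe]
      linarith [hcos K hK]
    have hs0 : 0 < |s| := by linarith
    refine (_root_.condNumber_le hcard _ (c := |s| / 2) (R := |s| + 2 * R) (by positivity)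
      (by positivity)
      (le_norm_toEuclideanLin_stackedToeplitz a s (by positivity) hlow)
      (norm_toEuclideanLin_stackedToeplitz_le a s (by positivity) hup)).trans ?_
    refine ENNReal.ofReal_le_ofReal ?_
    rw [div_le_iff₀ (by positivity)]
    nlinarith
  · refine (_root_.condNumber_le hcard _ (c := (2 ^ 23)⁻¹) (R := 6 * R) (by positivity)
      (by positivity)
      (le_norm_toEuclideanLin_of_no_cluster hn a s h.exists_unique_neighbour)
      (norm_toEuclideanLin_stackedToeplitz_le a s (by positivity)
        fun k => (hup k).trans (by linarith))).trans ?_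
    refine ENNReal.ofReal_le_ofReal ?_
    rw [div_inv_eq_mul]
    nlinarith

theorem injective_vec3 {α : Type*} {x y z : α} (hxy : x ≠ y) (hxz : x ≠ z) (hyz : y ≠ z) :
    Function.Injective ![x, y, z] := by
  intro i j hij
  fin_cases i <;> fin_cases j <;> simp_all

/-! ### Union bound and conclusion. -/

/-- Main probabilistic estimate, in a form which covers the symmetric and the non-symmetric case:
the entries `a d` are folded to independent variables by the linear map `U`. -/
theorem exists_condNumber_le (μ : Measure ℝ) [IsProbabilityMeasure μ]
    (hL2 : MemLp id 2 μ) (hmean : ∫ x, x ∂μ = 0) (hvar : 0 < variance id μ)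
    (hmgf : HasMgfNearZero μ) :
    ∃ C K : ℝ, 0 < C ∧ 0 < K ∧ ∀ᶠ n : ℕ in atTop,
      ∀ (Ω : Type*) [MeasurableSpace Ω] (P : Measure Ω) [IsProbabilityMeasure P]
        (ξ : ℤ → Ω → ℝ) (ξs : Ω → ℝ), IsIID P μ ξ → Measurable ξs →
        ∀ (J : Finset ℤ) (U : (ℤ → ℝ) →ₗ[ℝ] (ℤ → ℝ)) (a : ℤ → Ω → ℝ),
        J.card ≤ 2 * n →
        (∀ v : ℤ → ℝ, IndepFun (fun ω => ∑ j ∈ J, v j * ξ j ω) ξs P) →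
        (∀ (f : ℤ → ℝ) (ω : Ω),
          ∑ d ∈ Finset.Ioo (-(n : ℤ)) n, a d ω * f d = ∑ j ∈ J, U f j * ξ j ω) →
        (∀ f : ℤ → ℝ, (∀ d, |f d| ≤ 1) → ∀ j, |U f j| ≤ 2) →
        (∀ f : ℤ → ℝ, (∀ d, f (-d) = f d) →
          ∑ d ∈ Finset.Ioo (-(n : ℤ)) n, f d ^ 2 ≤ ∑ j ∈ J, U f j ^ 2) →
        1 - C * (√(n : ℝ))⁻¹ ≤
          P.real {ω | condNumber (stackedToeplitz n (fun j => a j ω) (ξs ω)) ≤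
            ENNReal.ofReal (K * √(n * Real.log n))} := by
  obtain ⟨C1, hC1, hball1⟩ := exists_smallBall_linearForms μ hL2 hmean hvar 1
  obtain ⟨C3, hC3, hball3⟩ := exists_smallBall_linearForms μ hL2 hmean hvar 3
  obtain ⟨K, hK, htail⟩ := exists_tail_linearForm μ hmean hmgf
  refine ⟨2 * (2 * (2 ^ 15 + 1)) * C1 + 8 * (2 ^ 16 + 1) ^ 2 * C3 + 12, 2 ^ 26 * K, by positivity,
    by positivity, ?_⟩
  have hlarge : ∀ᶠ n : ℕ in atTop, 1 ≤ K * √(n * Real.log n) := by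
    have h1 : Tendsto (fun n : ℕ => K * √((n : ℝ) * Real.log n)) atTop atTop := by
      refine Tendsto.const_mul_atTop hK (Real.tendsto_sqrt_atTop.comp ?_)
      exact tendsto_natCast_atTop_atTop.atTop_mul_atTop₀
        (Real.tendsto_log_atTop.comp tendsto_natCast_atTop_atTop)
    exact h1.eventually_ge_atTop 1
  filter_upwards [htail, hlarge, eventually_ge_atTop (2 ^ 17)] with n htail hlarge hn
  intro Ω _ P _ ξ ξs hξ hξs J U a hJ hind hU hU2 hUsq
  set R := K * √(n * Real.log n) with hR
  have hn0 : (0 : ℝ) < n := by exact_mod_cast (by omega : 0 < n)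
  have hn17 : (2 ^ 17 : ℝ) ≤ n := by exact_mod_cast hn
  -- For at most three frequencies the Gram bound n - d is at least n/2, so each linear form costs
  -- one factor q.
  set q : ℝ := (√((n : ℝ) / 2))⁻¹ with hq
  have hq0 : 0 < q := by positivity
  have hq2 : q ^ 2 = 2 / n := by
    rw [hq, inv_pow, Real.sq_sqrt (by positivity), inv_div]
  have hqle : q ≤ 2 * (√(n : ℝ))⁻¹ := by
    refine le_of_sq_le_sq ?_ (by positivity)
    rw [hq2, mul_pow, inv_pow, Real.sq_sqrt hn0.le, div_eq_mul_inv]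
    gcongr
    norm_num
  set cosv : ℤ → ℤ → ℝ := fun k d => Real.cos (Real.pi * d * k / n) with hcosv
  have hcos1 : ∀ k d, |cosv k d| ≤ 1 := fun k d => Real.abs_cos_le_one _
  have hre : ∀ k ω, eigenvalueRe n (fun j => a j ω) (ξs ω) k
      = ∑ j ∈ J, U (cosv k) j * ξ j ω + Real.cos (Real.pi * k) * ξs ω := fun k ω => by
    rw [← hU, eigenvalueRe, mul_comm (ξs ω)]
  have hgram : ∀ (d : ℕ) (k : Fin d → ℤ), (d : ℝ) ≤ n / 2 → Function.Injective k →
      (∀ i, 0 ≤ k i) → (∀ i, k i ≤ n) → ∀ θ : Fin d → ℝ,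
      (n : ℝ) / 2 * ∑ i, θ i ^ 2 ≤ ∑ j ∈ J, (∑ i, θ i * U (cosv (k i)) j) ^ 2 := by
    intro d k hd hk hk0 hkn θ
    have h1 := le_sum_Ioo_sq_sum_cos (by omega : 0 < n) k hk hk0 hkn θ
    -- By linearity of U, the energy inequality for the single even function Σ θ_i cos transfers the
    -- Gram bound to the folded coefficients.
    have h2 := hUsq (∑ i, θ i • cosv (k i)) (fun e => by
      simp only [Finset.sum_apply, Pi.smul_apply, hcosv, Int.cast_neg, mul_neg, neg_mul, neg_div,
        Real.cos_neg])
    simp only [map_sum, map_smul, Finset.sum_apply, Pi.smul_apply, smul_eq_mul] at h2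
    refine le_trans ?_ (h1.trans h2)
    have h3 : 0 ≤ ∑ i, θ i ^ 2 := Finset.sum_nonneg fun i _ => sq_nonneg _
    exact mul_le_mul_of_nonneg_right (by linarith) h3
  have hsingle : ∀ k : ℤ, 0 ≤ k → k ≤ n →
      P.real {ω | |eigenvalueRe n (fun j => a j ω) (ξs ω) k| ≤ 1} ≤ C1 * q := by
    intro k hk0 hkn
    have h := hball1 Ω P ξ ξs hξ hξs J hind (fun _ => U (cosv k)) (fun _ => Real.cos (Real.pi * k))
      (n / 2) (fun _ => hU2 _ (hcos1 k)) (by positivity)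
      (hgram 1 (fun _ => k) (by push_cast; linarith) (Function.injective_of_subsingleton _)
        (fun _ => hk0) (fun _ => hkn))
    rw [pow_one] at h
    refine (measureReal_mono fun ω hω => ?_).trans h
    intro _
    rw [← hre]
    exact hω
  have htriple : ∀ k1 k2 k3 : ℤ, 0 ≤ k1 → k1 ≤ n → 0 ≤ k2 → k2 ≤ n → 0 ≤ k3 → k3 ≤ n →
      k1 ≠ k2 → k1 ≠ k3 → k2 ≠ k3 →
      P.real {ω | |eigenvalueRe n (fun j => a j ω) (ξs ω) k1| ≤ 1 ∧
        |eigenvalueRe n (fun j => a j ω) (ξs ω) k2| ≤ 1 ∧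
        |eigenvalueRe n (fun j => a j ω) (ξs ω) k3| ≤ 1} ≤ C3 * q ^ 3 := by
    intro k1 k2 k3 h1 h1' h2 h2' h3 h3' h12 h13 h23
    have h := hball3 Ω P ξ ξs hξ hξs J hind (fun i => U (cosv (![k1, k2, k3] i)))
      (fun i => Real.cos (Real.pi * (![k1, k2, k3] i : ℤ)))
      (n / 2) (fun _ => hU2 _ (hcos1 _)) (by positivity)
      (hgram 3 ![k1, k2, k3] (by push_cast; linarith) (injective_vec3 h12 h13 h23)
        (Fin.forall_fin_succ.2 ⟨h1, Fin.forall_fin_two.2 ⟨h2, h3⟩⟩)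
        (Fin.forall_fin_succ.2 ⟨h1', Fin.forall_fin_two.2 ⟨h2', h3'⟩⟩))
    refine (measureReal_mono fun ω hω => ?_).trans h
    have h4 : ∀ i, |eigenvalueRe n (fun j => a j ω) (ξs ω) (![k1, k2, k3] i)| ≤ 1 :=
      Fin.forall_fin_succ.2 ⟨hω.1, Fin.forall_fin_two.2 hω.2⟩
    intro i
    rw [← hre]
    exact h4 i
  set E0 : Finset ℤ := Finset.Icc (0 : ℤ) (2 ^ 15) ∪ Finset.Icc ((n : ℤ) - 2 ^ 15) n with hE0
  have hE0mem : ∀ k ∈ E0, 0 ≤ k ∧ k ≤ n := by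
    intro k hk
    simp only [hE0, Finset.mem_union, Finset.mem_Icc] at hk
    omega
  have hE0card : (E0.card : ℝ) ≤ 2 * (2 ^ 15 + 1) := by
    have h : E0.card ≤ (Finset.Icc (0 : ℤ) (2 ^ 15)).card +
        (Finset.Icc ((n : ℤ) - 2 ^ 15) (n : ℤ)).card :=
      Finset.card_union_le _ _
    rw [Int.card_Icc, Int.card_Icc] at h
    have h' : E0.card ≤ 2 * (2 ^ 15 + 1) := by omega
    exact_mod_cast h'
  set D : Finset ℤ := Finset.Icc (-2 ^ 15) (2 ^ 15) with hD
  set T : Finset (ℤ × ℤ × ℤ) := (Finset.Icc (0 : ℤ) n ×ˢ D ×ˢ D).filter fun t =>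
    0 ≤ t.1 + t.2.1 ∧ t.1 + t.2.1 ≤ n ∧ 0 ≤ t.1 + t.2.2 ∧ t.1 + t.2.2 ≤ n ∧
      t.2.1 ≠ 0 ∧ t.2.2 ≠ 0 ∧ t.2.1 ≠ t.2.2 with hT
  have hTcard : (T.card : ℝ) ≤ 2 * n * (2 ^ 16 + 1) ^ 2 := by
    have h1 : T.card ≤ (n + 1) * ((2 ^ 16 + 1) * (2 ^ 16 + 1)) := by
      refine (Finset.card_filter_le _ _).trans_eq ?_
      have hDcard : D.card = 2 ^ 16 + 1 := by rw [hD, Int.card_Icc]; rfl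
      have hncard : ((n : ℤ) + 1 - 0).toNat = n + 1 := by omega
      rw [Finset.card_product, Finset.card_product, Int.card_Icc, hDcard, hncard]
    have h2 : (T.card : ℝ) ≤ (n + 1) * ((2 ^ 16 + 1) * (2 ^ 16 + 1)) := by exact_mod_cast h1
    refine h2.trans ?_
    rw [sq]
    gcongr
    linarith
  set A0 : Set Ω := ⋃ k ∈ E0, {ω | |eigenvalueRe n (fun j => a j ω) (ξs ω) k| ≤ 1} with hA0
  set A1 : Set Ω := ⋃ t ∈ T, {ω | |eigenvalueRe n (fun j => a j ω) (ξs ω) t.1| ≤ 1 ∧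
    |eigenvalueRe n (fun j => a j ω) (ξs ω) (t.1 + t.2.1)| ≤ 1 ∧
    |eigenvalueRe n (fun j => a j ω) (ξs ω) (t.1 + t.2.2)| ≤ 1} with hA1
  set A2 : Set Ω := ⋃ k ∈ Finset.Icc (-(n : ℤ)) n,
    ({ω | R ≤ |∑ j ∈ J, U (cosv k) j * ξ j ω|} ∪
      {ω | R ≤ |∑ j ∈ J, U (fun d => Real.sin (Real.pi * d * k / n)) j * ξ j ω|}) with hA2
  have hP0 : P.real A0 ≤ 2 * (2 * (2 ^ 15 + 1)) * C1 * (√(n : ℝ))⁻¹ := by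
    calc P.real A0 ≤ ∑ k ∈ E0, C1 * q := by
          refine (measureReal_biUnion_finset_le _ _).trans (Finset.sum_le_sum fun k hk => ?_)
          exact hsingle k (hE0mem k hk).1 (hE0mem k hk).2
      _ = E0.card * (C1 * q) := by rw [Finset.sum_const, nsmul_eq_mul]
      _ ≤ 2 * (2 ^ 15 + 1) * (C1 * (2 * (√(n : ℝ))⁻¹)) := by gcongr
      _ = _ := by ring
  -- There are O(n) triples of probability O(n^{-3/2}) each. Pairs would give O(n) · O(n^{-1}),
  -- which is not small; hence the uncertainty principle has to tolerate one neighbour.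
  have hP1 : P.real A1 ≤ 8 * (2 ^ 16 + 1) ^ 2 * C3 * (√(n : ℝ))⁻¹ := by
    calc P.real A1 ≤ ∑ t ∈ T, C3 * q ^ 3 := by
          refine (measureReal_biUnion_finset_le _ _).trans (Finset.sum_le_sum fun t ht => ?_)
          obtain ⟨ht1, h1, h2, h3, h4, h5, h6, h7⟩ := Finset.mem_filter.1 ht
          have ht2 := Finset.mem_Icc.1 (Finset.mem_product.1 ht1).1
          exact htriple _ _ _ ht2.1 ht2.2 h1 h2 h3 h4 (by omega) (by omega) (by omega)
      _ = T.card * (C3 * q ^ 3) := by rw [Finset.sum_const, nsmul_eq_mul]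
      _ ≤ 2 * n * (2 ^ 16 + 1) ^ 2 * (C3 * q ^ 3) := by gcongr
      _ = 4 * (2 ^ 16 + 1) ^ 2 * C3 * q := by
          rw [show q ^ 3 = q ^ 2 * q by ring, hq2]
          field_simp
          ring
      _ ≤ 4 * (2 ^ 16 + 1) ^ 2 * C3 * (2 * (√(n : ℝ))⁻¹) := by gcongr
      _ = _ := by ring
  have hP2 : P.real A2 ≤ 12 * (√(n : ℝ))⁻¹ := by
    calc P.real A2 ≤ ∑ k ∈ Finset.Icc (-(n : ℤ)) n, (2 / (n : ℝ) ^ 3 + 2 / (n : ℝ) ^ 3) := by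
          refine (measureReal_biUnion_finset_le _ _).trans (Finset.sum_le_sum fun k _ => ?_)
          refine (measureReal_union_le _ _).trans (add_le_add ?_ ?_)
          · exact htail Ω P ξ hξ J _ hJ (hU2 _ (hcos1 k))
          · exact htail Ω P ξ hξ J _ hJ (hU2 _ fun d => Real.abs_sin_le_one _)
      _ = (2 * n + 1) * (4 / (n : ℝ) ^ 3) := by
          rw [Finset.sum_const, nsmul_eq_mul, Int.card_Icc]
          have : ((n : ℤ) + 1 - -(n : ℤ)).toNat = 2 * n + 1 := by omega
          rw [this]
          push_cast
          ring
      _ ≤ (3 * n) * (4 / (n : ℝ) ^ 3) := by gcongr; linarith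
      _ = 12 * ((n : ℝ) ^ 2)⁻¹ := by field_simp; norm_num
      _ ≤ 12 * (√(n : ℝ))⁻¹ := by
          gcongr
          rw [Real.sqrt_le_left (by positivity)]
          calc (n : ℝ) = (n : ℝ) ^ 1 := (pow_one _).symm
            _ ≤ (n : ℝ) ^ 4 := pow_le_pow_right₀ (by linarith) (by norm_num)
            _ = ((n : ℝ) ^ 2) ^ 2 := by ring
  set good : Set Ω := {ω | condNumber (stackedToeplitz n (fun j => a j ω) (ξs ω)) ≤
    ENNReal.ofReal (2 ^ 26 * K * √(n * Real.log n))} with hgood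
  have hcover : Set.univ ⊆ good ∪ (A0 ∪ (A1 ∪ A2)) := by
    intro ω _
    by_contra hω
    simp only [Set.mem_union, not_or] at hω
    obtain ⟨hg, h0, h1, h2⟩ := hω
    refine hg ?_
    have hcl : NoCluster n (fun j => a j ω) (ξs ω) := by
      constructor
      · intro k hk
        by_contra hc
        exact h0 (Set.mem_biUnion (x := k) hk (not_lt.1 hc))
      · intro k δ δ' hk hk' hδ hδ' hd hd' hb hb' hne hne' hdd hr hr'
        by_contra hc
        refine h1 (Set.mem_biUnion (x := (k, δ, δ')) ?_ ⟨hr, hr', not_lt.1 hc⟩)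
        have hb1 := abs_le.1 hb
        have hb2 := abs_le.1 hb'
        refine Finset.mem_filter.2 ⟨?_, hδ, hδ', hd, hd', hne, hne', hdd⟩
        simp only [Finset.mem_product, hD, Finset.mem_Icc]
        exact ⟨⟨hk, hk'⟩, hb1, hb2⟩
    have := hcl.condNumber_le (by omega) hlarge
      (fun k hk => by
        by_contra hc
        refine h2 (Set.mem_biUnion (x := k) hk (Or.inl ?_))
        change R ≤ |∑ j ∈ J, U (cosv k) j * ξ j ω|
        rw [← hU]
        exact (not_le.1 hc).le)
      (fun k hk => by
        by_contra hc
        refine h2 (Set.mem_biUnion (x := k) hk (Or.inr ?_))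
        change R ≤ |∑ j ∈ J, U (fun d => Real.sin (Real.pi * d * k / n)) j * ξ j ω|
        rw [← hU]
        exact (not_le.1 hc).le)
    rw [hR, ← mul_assoc] at this
    exact this
  have htotal : (1 : ℝ) ≤ P.real good + (P.real A0 + (P.real A1 + P.real A2)) := by
    calc (1 : ℝ) = P.real Set.univ := probReal_univ.symm
      _ ≤ P.real (good ∪ (A0 ∪ (A1 ∪ A2))) := measureReal_mono hcover
      _ ≤ _ := (measureReal_union_le _ _).trans (add_le_add le_rfl
          ((measureReal_union_le _ _).trans (add_le_add le_rfl (measureReal_union_le _ _))))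
  linarith

theorem indepFun_sum_of_indepFun_pi {Ω : Type*} [MeasurableSpace Ω] {P : Measure Ω}
    {ξ : ℤ → Ω → ℝ} {ξs : Ω → ℝ} {s : Set ℤ} (h : IndepFun (fun ω (j : s) => ξ j ω) ξs P)
    (J : Finset ℤ) (hJ : ∀ j ∈ J, j ∈ s) (v : ℤ → ℝ) :
    IndepFun (fun ω => ∑ j ∈ J, v j * ξ j ω) ξs P := by
  have hmeas : Measurable fun x : s → ℝ => ∑ j : J, v j * x ⟨j, hJ j j.2⟩ :=
    Finset.measurable_sum _ fun j _ => (measurable_pi_apply _).const_mul _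
  have h1 := h.comp hmeas measurable_id
  convert! h1 using 1
  ext ω
  exact (Finset.sum_coe_sort J fun j => v j * ξ j ω).symm

theorem mainTheorem10 (μ : Measure ℝ) [IsProbabilityMeasure μ]
    (hL2 : MemLp id 2 μ) (hmean : ∫ x, x ∂μ = 0) (hvar : 0 < variance id μ)
    (hmgf : HasMgfNearZero μ) (hH : ConditionH μ) :
    -- non-symmetric case
    (∃ C₀ C₁ : ℝ, 0 < C₀ ∧ 0 < C₁ ∧ ∃ o : ℕ → ℝ, Tendsto o atTop (𝓝 0) ∧
      ∀ ε : ℝ, 0 < ε → ∀ ρ : ℝ, 0 < ρ → ρ < 1 / 4 → ∀ᶠ n : ℕ in atTop,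
        ∀ (Ω : Type*) [MeasurableSpace Ω] (P : Measure Ω) [IsProbabilityMeasure P]
          (ξ : ℤ → Ω → ℝ) (ξs : Ω → ℝ), IsIID P μ ξ → Measurable ξs →
          IndepFun (fun ω (j : Set.Ioo (-(n : ℤ)) n) => ξ j ω) ξs P →
          1 - C₁ * ((ε ^ 2 + ε) * (n : ℝ) ^ (-2 * ρ) + (n : ℝ) ^ (-(1 / 2 : ℝ) + o n))
            ≤ P.real {ω | condNumber (stackedToeplitz n (fun j => ξ j ω) (ξs ω)) ≤
                ENNReal.ofReal
                  (C₀ / ε * (n : ℝ) ^ (ρ + 1 / 2) * (Real.log n) ^ (1 / 2 : ℝ))}) ∧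
    -- symmetric case
    (∃ C₀ C₁ : ℝ, 0 < C₀ ∧ 0 < C₁ ∧ ∃ o : ℕ → ℝ, Tendsto o atTop (𝓝 0) ∧
      ∀ ε : ℝ, 0 < ε → ∀ᶠ n : ℕ in atTop,
        ∀ (Ω : Type*) [MeasurableSpace Ω] (P : Measure Ω) [IsProbabilityMeasure P]
          (ξ : ℤ → Ω → ℝ) (ξs : Ω → ℝ), IsIID P μ ξ → Measurable ξs →
          IndepFun (fun ω (j : Set.Ico (0 : ℤ) n) => ξ j ω) ξs P →
          1 - C₁ * (ε * (n : ℝ) ^ (-(0.1 : ℝ)) + (n : ℝ) ^ (-(77 / 300 : ℝ) + o n))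
            ≤ P.real {ω | condNumber (stackedToeplitz n (fun j => ξ |j| ω) (ξs ω)) ≤
                ENNReal.ofReal
                  (C₀ / ε * (n : ℝ) ^ (1.01 : ℝ) * (Real.log n) ^ (1 / 2 : ℝ))}) := by
  -- For fixed ε the growing factor n^β eventually exceeds Kε, so C₀ = 1 suffices.
  have hpow : ∀ K ε β : ℝ, 0 < ε → 0 < β → ∀ᶠ n : ℕ in atTop,
      K * √(n * Real.log n) ≤ 1 / ε * (n : ℝ) ^ (β + 1 / 2) * (Real.log n) ^ (1 / 2 : ℝ) := by
    intro K ε β hε hβ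
    have h1 := (tendsto_rpow_atTop hβ).comp tendsto_natCast_atTop_atTop
    filter_upwards [h1.eventually_ge_atTop (K * ε), eventually_ge_atTop 1] with n hn hn1
    have hn0 : (0 : ℝ) < n := by exact_mod_cast hn1
    rw [Real.sqrt_mul hn0.le, Real.sqrt_eq_rpow, Real.sqrt_eq_rpow, Real.rpow_add hn0, ← mul_assoc,
      ← mul_assoc]
    have h2 : K ≤ 1 / ε * (n : ℝ) ^ β := by
      rw [one_div, ← div_eq_inv_mul, le_div_iff₀ hε]
      exact hn
    have hlog := Real.log_natCast_nonneg n
    gcongr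
  constructor
  · obtain ⟨C, K, hC, hK, hmain⟩ := exists_condNumber_le μ hL2 hmean hvar hmgf
    refine ⟨1, C, one_pos, hC, fun _ => 0, tendsto_const_nhds, fun ε hε ρ hρ _ => ?_⟩
    filter_upwards [hmain, hpow K ε ρ hε hρ, eventually_ge_atTop 1] with n hn hpown hn1
    intro Ω _ P _ ξ ξs hξ hξs hind
    have hn0 : (0 : ℝ) < n := by exact_mod_cast hn1
    have h := hn Ω P ξ ξs hξ hξs (Finset.Ioo (-(n : ℤ)) n) LinearMap.id ξ
      (by rw [Int.card_Ioo]; omega)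
      (indepFun_sum_of_indepFun_pi hind _ fun j hj => Finset.mem_Ioo.1 hj)
      (fun f ω => Finset.sum_congr rfl fun d _ => mul_comm _ _)
      (fun f hf j => (hf j).trans one_le_two) (fun f _ => le_rfl)
    refine le_trans ?_ (h.trans (measureReal_mono fun ω hω =>
      le_trans hω (ENNReal.ofReal_le_ofReal hpown)))
    rw [add_zero, Real.rpow_neg hn0.le, ← Real.sqrt_eq_rpow]
    have h1 : 0 ≤ (ε ^ 2 + ε) * (n : ℝ) ^ (-2 * ρ) := by positivity
    gcongr
    linarith
  · obtain ⟨C, K, hC, hK, hmain⟩ := exists_condNumber_le μ hL2 hmean hvar hmgf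
    refine ⟨1, C, one_pos, hC, fun _ => 0, tendsto_const_nhds, fun ε hε => ?_⟩
    -- The exponent 1.01 splits as 0.51 + 1/2: the half comes from √n, and 0.51 absorbs the
    -- constants.
    filter_upwards [hmain, hpow K ε 0.51 hε (by norm_num), eventually_ge_atTop 1]
      with n hn hpown hn1
    intro Ω _ P _ ξ ξs hξ hξs hind
    have hn1' : (1 : ℝ) ≤ n := by exact_mod_cast hn1
    have h := hn Ω P ξ ξs hξ hξs (Finset.Ico (0 : ℤ) n) symmetricFold (fun d => ξ |d|)
      (by rw [Int.card_Ico]; omega)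
      (indepFun_sum_of_indepFun_pi hind _ fun j hj => Finset.mem_Ico.1 hj)
      (fun f ω => sum_Ioo_abs_mul n (fun j => ξ j ω) f)
      (fun f hf j => by
        rw [symmetricFold_apply]
        split_ifs
        · exact (hf 0).trans one_le_two
        · linarith [abs_add_le (f j) (f (-j)), hf j, hf (-j)])
      (fun f hf => sum_Ioo_sq_le_sum_symmetricFold_sq n f hf)
    have hexp : (0.51 : ℝ) + 1 / 2 = 1.01 := by norm_num
    rw [hexp] at hpown
    refine le_trans ?_ (h.trans (measureReal_mono fun ω hω =>
      le_trans hω (ENNReal.ofReal_le_ofReal hpown)))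
    rw [add_zero, Real.sqrt_eq_rpow, ← Real.rpow_neg (by positivity)]
    have h1 : 0 ≤ ε * (n : ℝ) ^ (-(0.1 : ℝ)) := by positivity
    have h2 : (n : ℝ) ^ (-(1 / 2 : ℝ)) ≤ (n : ℝ) ^ (-(77 / 300 : ℝ)) :=
      Real.rpow_le_rpow_of_exponent_le hn1' (by norm_num)
    gcongr
    linarith
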